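/- Let $k$ be a field and let $Q$ be a quiver of type $\mathbb{A}_n$ with vertex set $Q_0=\{1,\dots,n\}$: for each $1\le i<n$ there is exactly one arrow between $i$ and $i+1$, in an arbitrary direction, and there are no other arrows. Representations of $Q$ over $k$ are finite dimensional, and $\underline{\dim}\,V\in\mathbb{Z}^n$ is the dimension vector of $V$. A tilting module is a representation $T$ with $\mathrm{Ext}^1(T,T)=0$ that is a direct sum of as many pairwise non-isomorphic indecomposables as the quiver has vertices. A support tilting module is a representation that is tilting when restricted to the full subquiver on its support. A $2$-support tilting module is a module $T$ with a decomposition $T=T^+\oplus T^-$ such that $T^+$ and $T^-$ are support tilting and $Q_0$ is the disjoint union of their supports. Let $\mathcal{T}^+(Q)$, $\mathcal{T}^{\mathrm{clus}}(Q)$ and $\mathcal{T}(Q)$ be the sets of isomorphism classes of tilting, support tilting and $2$-support tilting modules; isomorphisms of $2$-support tilting modules respect the decomposition. For a tilting module $T$, let $\sigma_T\subset\mathbb{R}^n$ be the convex hull of $0$ and the dimension vectors of the indecomposable direct summands of $T$. For a support tilting module $T$, let $\sigma_T$ be the convex hull of $0$, these dimension vectors, and the vectors $-e_j$ for all vertices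 $j$ outside the support of $T$. For a $2$-support tilting module, let $\sigma_T$ be the convex hull of $0$, the dimension vectors of the indecomposable direct summands of $T^+$, and the negatives of the dimension vectors of the indecomposable direct summands of $T^-$. Let $P^+(Q)$, $P^{\mathrm{clus}}(Q)$ and $P(Q)$ be the unions of the sets $\sigma_T$ over all tilting, all support tilting and all $2$-support tilting modules, respectively. Let $\mathrm{vol}$ be the integral volume on $\mathbb{R}^n$, that is, $n!$ times Lebesgue measure. Then the sets $\mathcal{T}^+(Q)$, $\mathcal{T}^{\mathrm{clus}}(Q)$ and $\mathcal{T}(Q)$ are finite, and $$\mathrm{vol}\,P^+(Q)=\sharp\mathcal{T}^+(Q),\qquad \mathrm{vol}\,P^{\mathrm{clus}}(Q)=\sharp\mathcal{T}^{\mathrm{clus}}(Q),\qquad \mathrm{vol}\,P(Q)=\sharp\mathcal{T}(Q).$$ Moreover, in each of the three cases, every $\sigma_T$ is a unimodular simplex (its vertices are $0$ and the members of a $\mathbb{Z}$-basis of $\mathbb{Z}^n$) and $\mathrm{vol}\,\sigma_T=1$; and if $T$ and $T'$ are non-isomorphic, then $\sigma_T\cap\sigma_{T'}$ has measure zero. 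-/

import Mathlib

open MeasureTheory
open scoped Nat ENNReal

universe u v w

/-- A finite-dimensional representation over the field `k` of a quiver with vertex set `Q`. -/
structure QuiverRep (k : Type u) [Field k] (Q : Type v) [Quiver.{w} Q] where
  space : Q → Type u
  [addCommGroup : ∀ i, AddCommGroup (space i)]
  [module : ∀ i, Module k (space i)]
  [finiteDimensional : ∀ i, FiniteDimensional k (space i)]
  map : ∀ {i j : Q}, (i ⟶ j) → (space i →ₗ[k] space j)

namespace QuiverRep

attribute [instance] QuiverRep.addCommGroup QuiverRep.module QuiverRep.finiteDimensional

section General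

variable {k : Type u} [Field k] {Q : Type v} [Quiver.{w} Q]

/-- An isomorphism of representations. -/
structure Iso (V W : QuiverRep k Q) where
  equiv : ∀ i, V.space i ≃ₗ[k] W.space i
  comm : ∀ {i j : Q} (a : i ⟶ j) (x : V.space i),
    equiv j (V.map a x) = W.map a (equiv i x)

/-- Two representations are isomorphic. -/
def IsIsomorphic (V W : QuiverRep k Q) : Prop := Nonempty (Iso V W)

theorem IsIsomorphic.refl (V : QuiverRep k Q) : IsIsomorphic V V :=
  ⟨⟨fun i => LinearEquiv.refl k (V.space i), fun _ _ => rfl⟩⟩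

theorem IsIsomorphic.symm {V W : QuiverRep k Q} (h : IsIsomorphic V W) :
    IsIsomorphic W V := by
  obtain ⟨e⟩ := h
  refine ⟨⟨fun i => (e.equiv i).symm, fun {i j} a x => ?_⟩⟩
  rw [LinearEquiv.symm_apply_eq, e.comm, LinearEquiv.apply_symm_apply]

theorem IsIsomorphic.trans {V W X : QuiverRep k Q} (h : IsIsomorphic V W)
    (h₂ : IsIsomorphic W X) : IsIsomorphic V X := by
  obtain ⟨e⟩ := h
  obtain ⟨f⟩ := h₂
  refine ⟨⟨fun i => (e.equiv i).trans (f.equiv i), fun {i j} a x => ?_⟩⟩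
  simp only [LinearEquiv.trans_apply, e.comm, f.comm]

variable (k Q) in
/-- Isomorphism as an equivalence relation on representations. -/
def isoSetoid : Setoid (QuiverRep k Q) where
  r := IsIsomorphic
  iseqv := ⟨IsIsomorphic.refl, IsIsomorphic.symm, IsIsomorphic.trans⟩

variable (k Q) in
/-- Isomorphism classes of representations. -/
def IsoClass : Type (max (u + 1) v w) := Quotient (isoSetoid k Q)

/-- The isomorphism class of a representation. -/
def isoClass (V : QuiverRep k Q) : IsoClass k Q := Quotient.mk (isoSetoid k Q) V

/-- The direct sum of two representations. -/
def prod (V W : QuiverRep k Q) : QuiverRep k Q where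
  space i := V.space i × W.space i
  map a := LinearMap.prodMap (V.map a) (W.map a)

/-- The direct sum of a finite family of representations. -/
def directSum {ι : Type} [Finite ι] (M : ι → QuiverRep k Q) : QuiverRep k Q where
  space i := ∀ x, (M x).space i
  map a := LinearMap.pi fun x => (M x).map a ∘ₗ LinearMap.proj x

/-- The zero representation, up to isomorphism. -/
def IsZero (V : QuiverRep k Q) : Prop := ∀ i, Subsingleton (V.space i)

/-- A nonzero representation without a nontrivial decomposition into a direct sum of two. -/
def IsIndecomposable (V : QuiverRep k Q) : Prop :=
  ¬ V.IsZero ∧ ∀ A B : QuiverRep k Q, IsIsomorphic V (A.prod B) → A.IsZero ∨ B.IsZero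

/-- `M` is (isomorphic to) a direct summand of `V`. -/
def IsSummand (M V : QuiverRep k Q) : Prop := ∃ N, IsIsomorphic V (M.prod N)

/-- The map `Hom(P⁰, W) → Hom(P¹, W)` induced by the standard projective resolution
`0 → P¹ → P⁰ → V → 0`, where `P⁰ = ⨁ᵢ P(i) ⊗ V(i)` (sum over the vertices) and
`P¹ = ⨁ₐ P(t a) ⊗ V(s a)` (sum over the arrows), after the identification
`Hom(P(i) ⊗ X, W) = Hom(X, W(i))`. Its kernel is `Hom(V, W)`. -/
def extMap (V W : QuiverRep k Q) :
    (∀ i : Q, V.space i →ₗ[k] W.space i) →ₗ[k]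
      (∀ (i j : Q), (i ⟶ j) → (V.space i →ₗ[k] W.space j)) where
  toFun f := fun i j a => f j ∘ₗ V.map a - W.map a ∘ₗ f i
  map_add' f g := by
    funext i j a
    ext x
    simp only [LinearMap.sub_apply, LinearMap.comp_apply, Pi.add_apply, LinearMap.add_apply,
      map_add]
    abel
  map_smul' c f := by
    funext i j a
    ext x
    simp [smul_sub]

/-- `Ext¹(V, W)`: the cokernel of `Hom(P⁰, W) → Hom(P¹, W)`. -/
abbrev Ext1 (V W : QuiverRep k Q) : Type _ :=
  (∀ (i j : Q), (i ⟶ j) → (V.space i →ₗ[k] W.space j)) ⧸ LinearMap.range (extMap V W)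

/-- `Ext¹(V, V) = 0`. -/
def IsRigid (V : QuiverRep k Q) : Prop := Subsingleton (Ext1 V V)

/-- A tilting module: rigid, and a direct sum of `n` pairwise non-isomorphic indecomposable
representations, where `n` is the number of vertices. -/
def IsTilting (T : QuiverRep k Q) : Prop :=
  T.IsRigid ∧ ∃ M : Fin (Nat.card Q) → QuiverRep k Q,
    (∀ x, (M x).IsIndecomposable) ∧
    (∀ x y, x ≠ y → ¬ IsIsomorphic (M x) (M y)) ∧
    IsIsomorphic T (directSum M)

/-- The set of vertices at which the dimension vector is nonzero. -/
def support (V : QuiverRep k Q) : Set Q := {i | Module.finrank k (V.space i) ≠ 0}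

/-- The full subquiver on a set of vertices. -/
instance fullSubquiver (I : Set Q) : Quiver.{w} I where
  Hom i j := (i : Q) ⟶ (j : Q)

/-- The restriction of a representation to the full subquiver on `I`. -/
def restrict (V : QuiverRep k Q) (I : Set Q) : QuiverRep k I where
  space i := V.space i
  map {i j} a := V.map (i := (i : Q)) (j := (j : Q)) a

/-- A support tilting module: tilting when restricted to its support. -/
def IsSupportTilting (T : QuiverRep k Q) : Prop := (T.restrict T.support).IsTilting

/-- A 2-support tilting module `T = T⁺ ⊕ T⁻`, given by the pair `(T⁺, T⁻)`: both are support
tilting, and the vertex set is the disjoint union of their supports. -/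
def IsTwoSupportTilting (T : QuiverRep k Q × QuiverRep k Q) : Prop :=
  T.1.IsSupportTilting ∧ T.2.IsSupportTilting ∧ IsCompl T.1.support T.2.support

variable (k Q) in
/-- The set of isomorphism classes of tilting modules. -/
def tiltingClasses : Set (IsoClass k Q) :=
  {c | ∃ T : QuiverRep k Q, T.IsTilting ∧ T.isoClass = c}

variable (k Q) in
/-- The set of isomorphism classes of support tilting modules. -/
def supportTiltingClasses : Set (IsoClass k Q) :=
  {c | ∃ T : QuiverRep k Q, T.IsSupportTilting ∧ T.isoClass = c}

variable (k Q) in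
/-- The set of isomorphism classes of 2-support tilting modules (an isomorphism respects the
decomposition `T = T⁺ ⊕ T⁻`). -/
def twoSupportTiltingClasses : Set (IsoClass k Q × IsoClass k Q) :=
  {c | ∃ T : QuiverRep k Q × QuiverRep k Q,
    IsTwoSupportTilting T ∧ (T.1.isoClass, T.2.isoClass) = c}

/-- The dimension vector, as a vector in `ℝ^Q`. -/
noncomputable def dimVec (V : QuiverRep k Q) : Q → ℝ :=
  fun i => (Module.finrank k (V.space i) : ℝ)

/-- The dimension vectors of the indecomposable direct summands of `T`. -/
def summandDims (T : QuiverRep k Q) : Set (Q → ℝ) :=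
  {d | ∃ M : QuiverRep k Q, M.IsIndecomposable ∧ M.IsSummand T ∧ d = M.dimVec}

/-- The simplex of a tilting module: the convex hull of `0` and the dimension vectors of the
indecomposable direct summands. -/
def simplexTilt (T : QuiverRep k Q) : Set (Q → ℝ) :=
  convexHull ℝ ({0} ∪ T.summandDims)

/-- The simplex of a support tilting module: add to the generators the negatives of the
standard basis vectors at the vertices outside the support. -/
def simplexSupp [DecidableEq Q] (T : QuiverRep k Q) : Set (Q → ℝ) :=
  convexHull ℝ ({0} ∪ T.summandDims ∪ {d | ∃ j, j ∉ T.support ∧ d = -Pi.single j (1 : ℝ)})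

/-- The simplex of a 2-support tilting module `T = T⁺ ⊕ T⁻`. -/
def simplexTwo (T : QuiverRep k Q × QuiverRep k Q) : Set (Q → ℝ) :=
  convexHull ℝ ({0} ∪ T.1.summandDims ∪ {d | -d ∈ T.2.summandDims})

variable (k Q) in
/-- `P⁺(Q)`, the union of the simplices of all tilting modules. -/
def polyTilt : Set (Q → ℝ) :=
  {x | ∃ T : QuiverRep k Q, T.IsTilting ∧ x ∈ T.simplexTilt}

variable (k Q) in
/-- `P^clus(Q)`, the union of the simplices of all support tilting modules. -/
def polySupp [DecidableEq Q] : Set (Q → ℝ) :=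
  {x | ∃ T : QuiverRep k Q, T.IsSupportTilting ∧ x ∈ T.simplexSupp}

variable (k Q) in
/-- `P(Q)`, the union of the simplices of all 2-support tilting modules. -/
def polyTwo : Set (Q → ℝ) :=
  {x | ∃ T : QuiverRep k Q × QuiverRep k Q, IsTwoSupportTilting T ∧ x ∈ simplexTwo T}

end General

end QuiverRep

/-- The integral volume on `ℝ^Q` with `n = |Q|`: `n!` times Lebesgue measure. -/
noncomputable def integralVolume {Q : Type v} [Fintype Q] (S : Set (Q → ℝ)) : ℝ≥0∞ :=
  ((Fintype.card Q)! : ℝ≥0∞) * volume S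

/-- A simplex with vertices `0` and the members of a `ℤ`-basis of `ℤ^Q`. -/
def IsUnimodularSimplex {Q : Type v} (S : Set (Q → ℝ)) : Prop :=
  ∃ b : Module.Basis Q ℤ (Q → ℤ),
    S = convexHull ℝ ({0} ∪ Set.range fun x => fun i => ((b x i : ℤ) : ℝ))

/-- The vertex set of the quiver of type `A_n` with orientation `o`. The edge `e` joins the
vertices `e` and `e + 1`; it points to `e + 1` if `o e = true` and to `e` otherwise. -/
def TypeA (n : ℕ) (_o : Fin (n - 1) → Bool) : Type := Fin n

namespace TypeA

variable {n : ℕ} {o : Fin (n - 1) → Bool}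

instance : Fintype (TypeA n o) := inferInstanceAs (Fintype (Fin n))

instance : DecidableEq (TypeA n o) := inferInstanceAs (DecidableEq (Fin n))

/-- The position `0, …, n - 1` of a vertex. -/
def pos (i : TypeA n o) : ℕ := Fin.val (n := n) i

instance : Quiver (TypeA n o) where
  Hom i j := {e : Fin (n - 1) //
    (o e = true ∧ i.pos = e ∧ j.pos = e + 1) ∨ (o e = false ∧ i.pos = e + 1 ∧ j.pos = e)}

end TypeA

/-
Order the vertices along the line. The indecomposable representations are the interval
representations, so a rigid module is described by a set of pairwise compatible intervals, where
compatibility (vanishing of both `Ext¹` groups) is a condition on the directions of the arrows next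
to the endpoints. Compatibility makes the cones over these sets a simplicial fan: a nonnegative
combination of interval vectors determines its coefficients, which are recovered by scanning the
line from left to right and comparing the total weights of the intervals that are still open.
Vertices outside the support, and the second summand of a 2-support tilting module, only add
negative coordinates on a complementary set of vertices, so they give fans as well. Hence the
summands of a tilting object are linearly independent, and simplices of different objects overlap in
a null set. Finally the interval vectors are differences of prefix indicator vectors, hence form a
totally unimodular family, so a linearly independent family of `n` of them is a `ℤ`-basis and its
simplex has integral volume `1`. The total volume therefore counts the objects.
-/

namespace QuiverRep

section Summands

variable {k : Type u} [Field k] {Q : Type v} [Quiver.{w} Q]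

/-- A morphism of representations: linear maps at the vertices, commuting with the arrows. -/
structure Hom (V W : QuiverRep k Q) where
  app : ∀ i, V.space i →ₗ[k] W.space i
  naturality : ∀ {i j : Q} (α : i ⟶ j) (x : V.space i), app j (V.map α x) = W.map α (app i x)

/-- The kernel of a morphism, as a subrepresentation of its source. -/
def Hom.ker {V W : QuiverRep k Q} (f : Hom V W) : QuiverRep k Q where
  space i := LinearMap.ker (f.app i)
  map α := (V.map α).restrict fun x hx => by
    rw [LinearMap.mem_ker] at hx ⊢
    rw [f.naturality, hx, map_zero]

/-- The composite of two morphisms of representations. -/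
def Hom.comp {V W X : QuiverRep k Q} (g : Hom W X) (f : Hom V W) : Hom V X where
  app i := g.app i ∘ₗ f.app i
  naturality α x := by simp only [LinearMap.comp_apply, f.naturality, g.naturality]

/-- The morphism underlying an isomorphism. -/
def Iso.hom {V W : QuiverRep k Q} (e : Iso V W) : Hom V W := ⟨fun i => e.equiv i, e.comm⟩

/-- The inverse of an isomorphism, as a morphism. -/
def Iso.inv {V W : QuiverRep k Q} (e : Iso V W) : Hom W V where
  app i := (e.equiv i).symm
  naturality α x := by
    simp only [LinearEquiv.coe_coe, LinearEquiv.symm_apply_eq, e.comm,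
      LinearEquiv.apply_symm_apply]

/-- The decomposition `F ≅ E ⊕ ker r` given by a retraction `r` of `s : E → F`. -/
def splitEquiv {E F : Type*} [AddCommGroup E] [Module k E] [AddCommGroup F] [Module k F]
    (s : E →ₗ[k] F) (r : F →ₗ[k] E) (h : ∀ x, r (s x) = x) : F ≃ₗ[k] E × LinearMap.ker r where
  toFun y := (r y, ⟨y - s (r y), by simp [h]⟩)
  map_add' y z := Prod.ext (map_add r y z) (Subtype.ext (by simp [add_sub_add_comm]))
  map_smul' c y := Prod.ext (map_smul r c y) (Subtype.ext (by simp [smul_sub]))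
  invFun p := s p.1 + p.2
  left_inv y := add_sub_cancel (s (r y)) y
  right_inv p := Prod.ext (by simp [h]) (Subtype.ext (by simp [h]))

theorem isIsomorphic_prod_ker {M V : QuiverRep k Q} (s : Hom M V) (r : Hom V M)
    (h : ∀ i x, r.app i (s.app i x) = x) : IsIsomorphic V (M.prod r.ker) := by
  refine ⟨⟨fun i => splitEquiv (s.app i) (r.app i) (h i), fun {i j} α y => ?_⟩⟩
  refine Prod.ext (r.naturality α y) (Subtype.ext ?_)
  change V.map α y - s.app j (r.app j (V.map α y)) = V.map α (y - s.app i (r.app i y))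
  rw [map_sub, r.naturality, s.naturality]

theorem isSummand_iff_exists_retraction {M V : QuiverRep k Q} :
    M.IsSummand V ↔ ∃ (s : Hom M V) (r : Hom V M), ∀ i x, r.app i (s.app i x) = x := by
  constructor
  · rintro ⟨N, ⟨e⟩⟩
    let inl : Hom M (M.prod N) := ⟨fun i => LinearMap.inl k (M.space i) (N.space i), fun α x =>
      Prod.ext rfl (map_zero (N.map α)).symm⟩
    let fst : Hom (M.prod N) M := ⟨fun i => LinearMap.fst k (M.space i) (N.space i),
      fun _ _ => rfl⟩
    refine ⟨e.inv.comp inl, fst.comp e.hom, fun i x => ?_⟩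
    exact congrArg Prod.fst ((e.equiv i).apply_symm_apply (x, 0))
  · rintro ⟨s, r, h⟩
    exact ⟨r.ker, isIsomorphic_prod_ker s r h⟩

theorem IsSummand.congr_left {M N V : QuiverRep k Q} (h : IsIsomorphic M N)
    (hM : M.IsSummand V) : N.IsSummand V := by
  obtain ⟨e⟩ := h
  obtain ⟨s, r, hsr⟩ := isSummand_iff_exists_retraction.1 hM
  refine isSummand_iff_exists_retraction.2 ⟨s.comp e.inv, e.hom.comp r, fun i x => ?_⟩
  change e.equiv i (r.app i (s.app i ((e.equiv i).symm x))) = x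
  rw [hsr, LinearEquiv.apply_symm_apply]

theorem IsSummand.congr_right {M V W : QuiverRep k Q} (h : IsIsomorphic V W)
    (hM : M.IsSummand V) : M.IsSummand W :=
  hM.imp fun _ hN => h.symm.trans hN

theorem isSummand_directSum {ι : Type} [Finite ι] (M : ι → QuiverRep k Q) (y : ι) :
    (M y).IsSummand (directSum M) := by
  classical
  let single : Hom (M y) (directSum M) :=
    ⟨fun i => LinearMap.single k (fun x => (M x).space i) y, fun {i j} α x => funext fun z =>
      (Pi.apply_single (fun z => (M z).map α) (fun z => map_zero ((M z).map α)) y x z).symm⟩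
  let proj : Hom (directSum M) (M y) := ⟨fun i => LinearMap.proj y, fun _ _ => rfl⟩
  exact isSummand_iff_exists_retraction.2 ⟨single, proj, fun i x =>
    Pi.single_eq_same (M := fun x => (M x).space i) y x⟩

theorem extMap_apply (V W : QuiverRep k Q) (f : ∀ i : Q, V.space i →ₗ[k] W.space i) {i j : Q}
    (α : i ⟶ j) (x : V.space i) :
    extMap V W f i j α x = f j (V.map α x) - W.map α (f i x) := rfl

theorem isRigid_iff_surjective_extMap {V : QuiverRep k Q} :
    V.IsRigid ↔ Function.Surjective (extMap V V) := by
  rw [IsRigid, Ext1, Submodule.Quotient.subsingleton_iff, LinearMap.range_eq_top]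

theorem IsSummand.surjective_extMap {M N V W : QuiverRep k Q} (hM : M.IsSummand V)
    (hN : N.IsSummand W) (h : Function.Surjective (extMap V W)) :
    Function.Surjective (extMap M N) := by
  obtain ⟨s, r, hsr⟩ := isSummand_iff_exists_retraction.1 hM
  obtain ⟨s', r', hsr'⟩ := isSummand_iff_exists_retraction.1 hN
  intro g
  obtain ⟨f, hf⟩ := h fun i j α => s'.app j ∘ₗ g i j α ∘ₗ r.app i
  refine ⟨fun i => r'.app i ∘ₗ f i ∘ₗ s.app i, ?_⟩
  funext i j α
  ext x
  have hfx := congrArg (r'.app j) (LinearMap.congr_fun (congrFun₃ hf i j α) (s.app i x))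
  simp only [extMap_apply, LinearMap.comp_apply, map_sub, hsr, hsr', ← s.naturality,
    r'.naturality] at hfx
  simpa only [extMap_apply, LinearMap.comp_apply, s.naturality] using hfx

end Summands

section Dimension

variable {k : Type u} [Field k] {Q : Type v} [Quiver.{w} Q]

theorem isoClass_eq_iff {V W : QuiverRep k Q} : V.isoClass = W.isoClass ↔ IsIsomorphic V W :=
  Quotient.eq (r := isoSetoid k Q)

theorem IsIsomorphic.finrank_eq {V W : QuiverRep k Q} (h : IsIsomorphic V W) (i : Q) :
    Module.finrank k (V.space i) = Module.finrank k (W.space i) :=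
  h.elim fun e => (e.equiv i).finrank_eq

theorem IsIsomorphic.dimVec_eq {V W : QuiverRep k Q} (h : IsIsomorphic V W) :
    V.dimVec = W.dimVec :=
  funext fun i => congrArg Nat.cast (h.finrank_eq i)

theorem IsIsomorphic.support_eq {V W : QuiverRep k Q} (h : IsIsomorphic V W) :
    V.support = W.support :=
  Set.ext fun i => not_congr (by rw [h.finrank_eq i])

theorem finrank_prod (V W : QuiverRep k Q) (i : Q) :
    Module.finrank k ((V.prod W).space i) =
      Module.finrank k (V.space i) + Module.finrank k (W.space i) :=
  Module.finrank_prod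

theorem IsSummand.support_subset {M V : QuiverRep k Q} (h : M.IsSummand V) :
    M.support ⊆ V.support := by
  obtain ⟨N, hN⟩ := h
  intro i hi
  rw [hN.support_eq]
  exact ((finrank_prod M N i).trans_ne (by have : Module.finrank k (M.space i) ≠ 0 := hi; omega))

theorem isZero_iff_finrank {V : QuiverRep k Q} :
    V.IsZero ↔ ∀ i, Module.finrank k (V.space i) = 0 :=
  forall_congr' fun _ => Module.finrank_zero_iff.symm

theorem isIsomorphic_prod_of_isZero {M N : QuiverRep k Q} (hN : N.IsZero) :
    IsIsomorphic (M.prod N) M := by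
  refine ⟨⟨fun i => ?_, ?_⟩⟩
  · have := hN i
    exact LinearEquiv.ofBijective (LinearMap.fst k (M.space i) (N.space i))
      ⟨fun x y hxy => Prod.ext hxy (Subsingleton.elim _ _), LinearMap.fst_surjective⟩
  · intro i j α x
    rfl

theorem IsIsomorphic.directSum_congr {ι : Type} [Finite ι] {M N : ι → QuiverRep k Q}
    (h : ∀ x, IsIsomorphic (M x) (N x)) : IsIsomorphic (directSum M) (directSum N) :=
  ⟨⟨fun i => LinearEquiv.piCongrRight fun x => (h x).some.equiv i,
    fun α x => funext fun y => (h y).some.comm α (x y)⟩⟩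

theorem IsIsomorphic.directSum_reindex {ι κ : Type} [Finite ι] [Finite κ] (e : κ ≃ ι)
    (M : ι → QuiverRep k Q) : IsIsomorphic (directSum M) (directSum fun x => M (e x)) :=
  ⟨⟨fun i => (LinearEquiv.piCongrLeft k (fun x => (M x).space i) e).symm, fun _ _ => rfl⟩⟩

end Dimension

section Thin

variable {k : Type u} [Field k] {Q : Type v} [Quiver.{w} Q]

/-- The scalars supported on a proposition: `k` if `p` holds and `0` otherwise. -/
def scalarsOn (k : Type u) [Field k] (p : Prop) : Submodule k k where
  carrier := {c | ¬ p → c = 0}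
  add_mem' ha hb h := by rw [ha h, hb h, add_zero]
  zero_mem' _ := rfl
  smul_mem' c x hx h := by rw [hx h, smul_zero]

open Classical in
/-- The identity of `k` between spaces of scalars whose propositions hold, and `0` otherwise. -/
noncomputable def scalarsOnMap (k : Type u) [Field k] (p q : Prop) :
    scalarsOn k p →ₗ[k] scalarsOn k q where
  toFun c := ⟨if q then c else 0, fun h => if_neg h⟩
  map_add' a b := by ext; by_cases h : q <;> simp [h]
  map_smul' a b := by ext; by_cases h : q <;> simp [h]

/-- The thin representation with a one-dimensional space at each vertex of `I`, zero elsewhere,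
and identity maps inside `I`. -/
noncomputable def thin (k : Type u) [Field k] {Q : Type v} [Quiver.{w} Q] (I : Set Q) :
    QuiverRep k Q where
  space i := scalarsOn k (i ∈ I)
  map {i j} _ := scalarsOnMap k (i ∈ I) (j ∈ I)

/-- The coordinate of a vector of a thin representation. -/
def thinCoord (k : Type u) [Field k] (I : Set Q) (i : Q) : (thin k I).space i →ₗ[k] k :=
  (scalarsOn k (i ∈ I)).subtype

theorem thinCoord_injective {I : Set Q} {i : Q} : Function.Injective (thinCoord k I i) :=
  Subtype.val_injective

theorem thinCoord_of_notMem {I : Set Q} {i : Q} (hi : i ∉ I) (c : (thin k I).space i) :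
    thinCoord k I i c = 0 := c.2 hi

open Classical in
theorem thinCoord_map {I : Set Q} {i j : Q} (α : i ⟶ j) (c : (thin k I).space i) :
    thinCoord k I j ((thin k I).map α c) = if j ∈ I then thinCoord k I i c else 0 := rfl

/-- The vector `1` at a vertex of `I` (and `0` elsewhere). -/
noncomputable def thinOne (k : Type u) [Field k] (I : Set Q) (i : Q) : (thin k I).space i :=
  scalarsOnMap k True (i ∈ I) ⟨1, fun h => absurd trivial h⟩

theorem thinCoord_thinOne {I : Set Q} {i : Q} (hi : i ∈ I) :
    thinCoord k I i (thinOne k I i) = 1 := if_pos hi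

theorem thinOne_of_notMem {I : Set Q} {i : Q} (hi : i ∉ I) : thinOne k I i = 0 :=
  thinCoord_injective (thinCoord_of_notMem hi _)

theorem map_thinOne {I : Set Q} {i j : Q} (hi : i ∈ I) (α : i ⟶ j) :
    (thin k I).map α (thinOne k I i) = thinOne k I j := by
  refine thinCoord_injective ?_
  rw [thinCoord_map, thinCoord_thinOne hi]
  rfl

theorem finrank_thin_of_mem {I : Set Q} {i : Q} (hi : i ∈ I) :
    Module.finrank k ((thin k I).space i) = 1 :=
  (LinearEquiv.ofBijective (thinCoord k I i) ⟨thinCoord_injective, fun c =>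
    ⟨⟨c, fun h => absurd hi h⟩, rfl⟩⟩).finrank_eq.trans (Module.finrank_self k)

theorem finrank_thin_of_notMem {I : Set Q} {i : Q} (hi : i ∉ I) :
    Module.finrank k ((thin k I).space i) = 0 :=
  Module.finrank_zero_iff.2 ⟨fun c d => thinCoord_injective
    ((thinCoord_of_notMem hi c).trans (thinCoord_of_notMem hi d).symm)⟩

theorem dimVec_thin (I : Set Q) : (thin k I).dimVec = I.indicator 1 := by
  funext i
  by_cases hi : i ∈ I
  · simp [dimVec, hi, finrank_thin_of_mem]
  · simp [dimVec, hi, finrank_thin_of_notMem]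

theorem support_thin (I : Set Q) : (thin k I).support = I := by
  ext i
  by_cases hi : i ∈ I
  · simp [support, hi, finrank_thin_of_mem]
  · simp [support, hi, finrank_thin_of_notMem]

theorem not_isZero_thin {I : Set Q} (hI : I.Nonempty) : ¬ (thin k I).IsZero := fun h =>
  hI.elim fun i hi => one_ne_zero ((finrank_thin_of_mem hi).symm.trans (isZero_iff_finrank.1 h i))

theorem injective_thin_map {I : Set Q} {i j : Q} (hj : j ∈ I) (α : i ⟶ j) :
    Function.Injective ((thin k I).map α) := fun c d hcd => thinCoord_injective <| by
  simpa only [thinCoord_map, if_pos hj] using congrArg (thinCoord k I j) hcd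

theorem isSummand_thin {V : QuiverRep k Q} {I : Set Q} (x : ∀ i, V.space i)
    (ξ : ∀ i, Module.Dual k (V.space i)) (hx : ∀ i ∉ I, x i = 0) (hξ : ∀ i ∉ I, ξ i = 0)
    (hone : ∀ i ∈ I, ξ i (x i) = 1)
    (map_x : ∀ {i j : Q} (α : i ⟶ j), i ∈ I → V.map α (x i) = x j)
    (ξ_comp_map : ∀ {i j : Q} (α : i ⟶ j), j ∈ I → ξ j ∘ₗ V.map α = ξ i) :
    (thin k I).IsSummand V := by
  refine isSummand_iff_exists_retraction.2
    ⟨⟨fun i => (thinCoord k I i).smulRight (x i), fun {i j} α c => ?_⟩,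
      ⟨fun i => (ξ i).codRestrict (scalarsOn k (i ∈ I)) fun y hi => by simp [hξ i hi],
        fun {i j} α y => ?_⟩, fun i c => ?_⟩
  · rw [LinearMap.smulRight_apply, LinearMap.smulRight_apply, map_smul, thinCoord_map]
    by_cases hi : i ∈ I <;> by_cases hj : j ∈ I <;>
      simp [hi, hj, hx, map_x, thinCoord_of_notMem]
  · refine thinCoord_injective ?_
    by_cases hj : j ∈ I
    · rw [thinCoord_map, if_pos hj]
      exact LinearMap.congr_fun (ξ_comp_map α hj) y
    · rw [thinCoord_map, if_neg hj]
      exact LinearMap.congr_fun (hξ j hj) (V.map α y)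
  · refine thinCoord_injective ?_
    change ξ i (thinCoord k I i c • x i) = thinCoord k I i c
    by_cases hi : i ∈ I
    · rw [map_smul, hone i hi, smul_eq_mul, mul_one]
    · rw [thinCoord_of_notMem hi, zero_smul, map_zero]

end Thin

/-- A quiver whose vertices sit at distinct natural numbers, with exactly one arrow between
vertices at consecutive positions and no other arrows. For `pos j = pos i + 1` the arrow goes from
`i` to `j` if `dir (pos i) = true`, and from `j` to `i` otherwise. Positions may be left out, so
that full subquivers of linear quivers are linear. -/
structure IsLinear (Q : Type v) [Quiver.{w} Q] (pos : Q → ℕ) (dir : ℕ → Bool) : Prop where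
  pos_injective : Function.Injective pos
  subsingleton_hom : ∀ i j : Q, Subsingleton (i ⟶ j)
  dir_of_hom : ∀ {i j : Q}, (i ⟶ j) → (dir (pos i) = true ∧ pos j = pos i + 1) ∨
    (dir (pos j) = false ∧ pos i = pos j + 1)
  hom_right : ∀ {i j : Q}, pos j = pos i + 1 → dir (pos i) = true → Nonempty (i ⟶ j)
  hom_left : ∀ {i j : Q}, pos j = pos i + 1 → dir (pos i) = false → Nonempty (j ⟶ i)

/-- The vertices at positions between `p.1` and `p.2`. -/
def interval {Q : Type v} (pos : Q → ℕ) (p : ℕ × ℕ) : Set Q :=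
  pos ⁻¹' Set.Icc p.1 p.2

/-- A nonempty interval of positions all of which carry a vertex. -/
def IsOccupied {Q : Type v} (pos : Q → ℕ) (p : ℕ × ℕ) : Prop :=
  p.1 ≤ p.2 ∧ ∀ e ∈ Set.Icc p.1 p.2, ∃ i, pos i = e

theorem IsOccupied.nonempty {Q : Type v} {pos : Q → ℕ} {p : ℕ × ℕ} (hp : IsOccupied pos p) :
    (interval pos p).Nonempty := by
  obtain ⟨i, hi⟩ := hp.2 p.1 ⟨le_rfl, hp.1⟩
  exact ⟨i, hi.ge, hi.le.trans hp.1⟩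

variable {k : Type u} [Field k] {Q : Type v} [Quiver.{w} Q] {pos : Q → ℕ} {dir : ℕ → Bool}

section Indecomposable

theorem IsLinear.eq_of_forall_hom {β : Type*} (hQ : IsLinear Q pos dir) {p : ℕ × ℕ}
    (hp : IsOccupied pos p) {d : Q → β}
    (hd : ∀ {i j : Q}, (i ⟶ j) → i ∈ interval pos p → j ∈ interval pos p → d i = d j) {i j : Q}
    (hi : i ∈ interval pos p) (hj : j ∈ interval pos p) : d i = d j := by
  obtain ⟨i₀, hi₀⟩ := hp.2 p.1 ⟨le_rfl, hp.1⟩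
  suffices h : ∀ e, p.1 ≤ e → e ≤ p.2 → ∀ i, pos i = e → d i = d i₀ from
    (h _ hi.1 hi.2 i rfl).trans (h _ hj.1 hj.2 j rfl).symm
  intro e he
  induction e, he using Nat.le_induction with
  | base => exact fun _ i hi => congrArg d (hQ.pos_injective (hi.trans hi₀.symm))
  | succ e he ih =>
    intro hep i hi
    obtain ⟨j, hj⟩ := hp.2 e ⟨he, by omega⟩
    have hji : pos i = pos j + 1 := by omega
    have hip : i ∈ interval pos p := ⟨by omega, by omega⟩
    have hjp : j ∈ interval pos p := ⟨by omega, by omega⟩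
    rw [← ih (by omega) j hj]
    cases hdir : dir (pos j) with
    | true => exact (hd (hQ.hom_right hji hdir).some hjp hip).symm
    | false => exact hd (hQ.hom_left hji hdir).some hip hjp

theorem finrank_add_finrank_of_prod_thin {A B : QuiverRep k Q} {I : Set Q}
    (h : IsIsomorphic (thin k I) (A.prod B)) (i : Q) :
    Module.finrank k (A.space i) + Module.finrank k (B.space i) =
      Module.finrank k ((thin k I).space i) := by
  rw [h.finrank_eq, finrank_prod]

theorem finrank_left_eq_of_prod_thin {A B : QuiverRep k Q} {I : Set Q}
    (h : IsIsomorphic (thin k I) (A.prod B)) {i j : Q} (α : i ⟶ j) (hi : i ∈ I) (hj : j ∈ I) :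
    Module.finrank k (A.space i) = Module.finrank k (A.space j) := by
  have hinj : Function.Injective ((A.prod B).map α) := by
    obtain ⟨e⟩ := h
    intro x y hxy
    obtain ⟨x, rfl⟩ := (e.equiv i).surjective x
    obtain ⟨y, rfl⟩ := (e.equiv i).surjective y
    rw [← e.comm, ← e.comm] at hxy
    exact congrArg _ (injective_thin_map hj α ((e.equiv j).injective hxy))
  have hA : Module.finrank k (A.space i) ≤ Module.finrank k (A.space j) :=
    LinearMap.finrank_le_finrank_of_injective (f := A.map α) fun x y hxy =>
      congrArg Prod.fst (@hinj (x, 0) (y, 0) (Prod.ext hxy rfl))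
  have hB : Module.finrank k (B.space i) ≤ Module.finrank k (B.space j) :=
    LinearMap.finrank_le_finrank_of_injective (f := B.map α) fun x y hxy =>
      congrArg Prod.snd (@hinj (0, x) (0, y) (Prod.ext rfl hxy))
  have hsum_i := finrank_add_finrank_of_prod_thin h i
  have hsum_j := finrank_add_finrank_of_prod_thin h j
  rw [finrank_thin_of_mem hi] at hsum_i
  rw [finrank_thin_of_mem hj] at hsum_j
  omega

theorem IsLinear.isIndecomposable_thin (hQ : IsLinear Q pos dir) {p : ℕ × ℕ}
    (hp : IsOccupied pos p) : (thin k (interval pos p)).IsIndecomposable := by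
  refine ⟨not_isZero_thin hp.nonempty, fun A B h => ?_⟩
  have hsum := finrank_add_finrank_of_prod_thin h
  obtain ⟨i₀, hi₀⟩ := hp.nonempty
  have hconst : ∀ i ∈ interval pos p,
      Module.finrank k (A.space i) = Module.finrank k (A.space i₀) := fun i hi =>
    hQ.eq_of_forall_hom hp (finrank_left_eq_of_prod_thin h) hi hi₀
  have h₀ := hsum i₀
  rw [finrank_thin_of_mem hi₀] at h₀
  rw [isZero_iff_finrank, isZero_iff_finrank]
  rcases Nat.eq_zero_or_pos (Module.finrank k (A.space i₀)) with hA | hA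
  · refine Or.inl fun i => ?_
    by_cases hi : i ∈ interval pos p
    · rw [hconst i hi, hA]
    · have := hsum i
      rw [finrank_thin_of_notMem hi] at this
      omega
  · refine Or.inr fun i => ?_
    have := hsum i
    by_cases hi : i ∈ interval pos p
    · rw [finrank_thin_of_mem hi, hconst i hi] at this
      omega
    · rw [finrank_thin_of_notMem hi] at this
      omega

end Indecomposable

section DualExtension

variable {E F : Type*} [AddCommGroup E] [Module k E] [AddCommGroup F] [Module k F]

theorem exists_dual_apply_eq_one {A : Submodule k E} {x : E} (hx : x ∉ A) :
    ∃ ξ : Module.Dual k E, ξ x = 1 ∧ A ≤ LinearMap.ker ξ := by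
  obtain ⟨f, hf, hA⟩ := Submodule.exists_le_ker_of_notMem hx
  exact ⟨(f x)⁻¹ • f, by simp [hf], hA.trans fun y hy => by simp_all⟩

theorem exists_dual_comp_eq (f : E →ₗ[k] F) {A : Submodule k F} {ξ : Module.Dual k E}
    (hξ : A.comap f ≤ LinearMap.ker ξ) :
    ∃ η : Module.Dual k F, η ∘ₗ f = ξ ∧ A ≤ LinearMap.ker η := by
  have hmem : ξ ∈ LinearMap.range (A.mkQ ∘ₗ f).dualMap := by
    rw [LinearMap.range_dualMap_eq_dualAnnihilator_ker, LinearMap.ker_comp, Submodule.ker_mkQ,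
      Submodule.mem_dualAnnihilator]
    exact fun y hy => hξ hy
  obtain ⟨η, rfl⟩ := hmem
  refine ⟨η ∘ₗ A.mkQ, rfl, ?_⟩
  rw [LinearMap.ker_comp]
  exact fun y hy => by simp [(Submodule.Quotient.mk_eq_zero A).2 hy]

theorem not_comap_le_comap (f : E →ₗ[k] F) {A B : Submodule k F} (hle : A ≤ B) (h : ¬ B ≤ A)
    (hB : B ≤ A ⊔ LinearMap.range f) : ¬ B.comap f ≤ A.comap f := fun hc => h <| by
  have hinf : LinearMap.range f ⊓ B ≤ A := by
    rw [← Submodule.map_comap_eq]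
    exact Submodule.map_le_iff_le_comap.2 hc
  calc B = (A ⊔ LinearMap.range f) ⊓ B := (inf_eq_right.2 hB).symm
    _ = A ⊔ LinearMap.range f ⊓ B := (sup_inf_assoc_of_le _ hle)
    _ ≤ A := sup_le le_rfl hinf

theorem not_map_le_map (f : E →ₗ[k] F) {A B : Submodule k E} (hle : A ≤ B) (h : ¬ B ≤ A)
    (hB : B ⊓ LinearMap.ker f ≤ A) : ¬ B.map f ≤ A.map f := fun hc => h <| by
  have hsup : B ≤ A ⊔ LinearMap.ker f := by
    rw [← Submodule.comap_map_eq]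
    exact Submodule.map_le_iff_le_comap.1 hc
  calc B = (A ⊔ LinearMap.ker f) ⊓ B := (inf_eq_right.2 hsup).symm
    _ = A ⊔ LinearMap.ker f ⊓ B := (sup_inf_assoc_of_le _ hle)
    _ ≤ A := sup_le le_rfl (inf_comm B _ ▸ hB)

end DualExtension

section Splitting

/-- Vectors `x` and functionals `ξ` that split off a copy of `thin k I` from the restriction of
`V` to the vertices at positions less than `b`. -/
structure PartialSplitting (V : QuiverRep k Q) (pos : Q → ℕ) (b : ℕ) (I : Set Q)
    (x : ∀ i, V.space i) (ξ : ∀ i, Module.Dual k (V.space i)) : Prop where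
  vec_eq_zero : ∀ i ∉ I, x i = 0
  dual_eq_zero : ∀ i ∉ I, ξ i = 0
  dual_apply_vec : ∀ i ∈ I, ξ i (x i) = 1
  map_vec : ∀ {i j : Q} (α : i ⟶ j), i ∈ I → pos i < b → pos j < b → V.map α (x i) = x j
  dual_comp_map : ∀ {i j : Q} (α : i ⟶ j), j ∈ I → pos i < b → pos j < b →
    ξ j ∘ₗ V.map α = ξ i

theorem PartialSplitting.empty (V : QuiverRep k Q) (pos : Q → ℕ) (b : ℕ) :
    PartialSplitting V pos b ∅ 0 0 :=
  ⟨fun _ _ => rfl, fun _ _ => rfl, fun _ hi => hi.elim, fun _ hi => hi.elim,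
    fun _ hj => hj.elim⟩

theorem IsLinear.pos_eq_of_hom (hQ : IsLinear Q pos dir) {i j : Q} (α : i ⟶ j) :
    pos j = pos i + 1 ∨ pos i = pos j + 1 :=
  (hQ.dir_of_hom α).imp And.right And.right

theorem IsLinear.ne_of_hom (hQ : IsLinear Q pos dir) {i j : Q} (α : i ⟶ j) : i ≠ j := by
  rintro rfl
  have := hQ.pos_eq_of_hom α
  omega

theorem IsLinear.isEmpty_hom_of_hom (hQ : IsLinear Q pos dir) {i j : Q} (α : i ⟶ j) :
    IsEmpty (j ⟶ i) := by
  refine ⟨fun β => ?_⟩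
  rcases hQ.dir_of_hom α with ⟨h, h'⟩ | ⟨h, h'⟩ <;> rcases hQ.dir_of_hom β with ⟨g, g'⟩ | ⟨g, g'⟩
  · omega
  · simp [h] at g
  · simp [h] at g
  · omega

theorem IsLinear.pos_lt_of_ne (hQ : IsLinear Q pos dir) {i m : Q} (hi : i ≠ m)
    (h : pos i < pos m + 1) : pos i < pos m :=
  (Nat.lt_succ_iff.1 h).lt_of_ne (hQ.pos_injective.ne hi)

open Classical in
theorem PartialSplitting.update (hQ : IsLinear Q pos dir) {V : QuiverRep k Q} {m : Q} {I : Set Q}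
    {x : ∀ i, V.space i} {ξ : ∀ i, Module.Dual k (V.space i)}
    (h : PartialSplitting V pos (pos m) I x ξ) {y : V.space m} {η : Module.Dual k (V.space m)}
    (hηy : η y = 1)
    (hin : ∀ {p : Q} (α : p ⟶ m), pos p < pos m →
      (p ∈ I → V.map α (x p) = y) ∧ η ∘ₗ V.map α = ξ p)
    (hout : ∀ {p : Q} (α : m ⟶ p), pos p < pos m →
      V.map α y = x p ∧ (p ∈ I → ξ p ∘ₗ V.map α = η)) :
    PartialSplitting V pos (pos m + 1) (insert m I) (Function.update x m y)
      (Function.update ξ m η) where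
  vec_eq_zero i hi := by
    rw [Function.update_of_ne fun hm => hi (Or.inl hm), h.vec_eq_zero i fun hI => hi (Or.inr hI)]
  dual_eq_zero i hi := by
    rw [Function.update_of_ne fun hm => hi (Or.inl hm), h.dual_eq_zero i fun hI => hi (Or.inr hI)]
  dual_apply_vec i hi := by
    by_cases hm : i = m
    · subst hm
      rwa [Function.update_self, Function.update_self]
    · rw [Function.update_of_ne hm, Function.update_of_ne hm]
      exact h.dual_apply_vec i (hi.resolve_left hm)
  map_vec {i j} α hi hib hjb := by
    have hij := hQ.ne_of_hom α
    rcases eq_or_ne i m with rfl | him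
    · rw [Function.update_self, Function.update_of_ne hij.symm]
      exact (hout α (hQ.pos_lt_of_ne hij.symm hjb)).1
    have hib := hQ.pos_lt_of_ne him hib
    rw [Function.update_of_ne him]
    rcases eq_or_ne j m with rfl | hjm
    · rw [Function.update_self, (hin α hib).1 (hi.resolve_left him)]
    · rw [Function.update_of_ne hjm,
        h.map_vec α (hi.resolve_left him) hib (hQ.pos_lt_of_ne hjm hjb)]
  dual_comp_map {i j} α hj hib hjb := by
    have hij := hQ.ne_of_hom α
    rcases eq_or_ne j m with rfl | hjm
    · rw [Function.update_self, Function.update_of_ne hij]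
      exact (hin α (hQ.pos_lt_of_ne hij hib)).2
    have hjb := hQ.pos_lt_of_ne hjm hjb
    rw [Function.update_of_ne hjm]
    rcases eq_or_ne i m with rfl | him
    · rw [Function.update_self, (hout α hjb).2 (hj.resolve_left hjm)]
    · rw [Function.update_of_ne him,
        h.dual_comp_map α (hj.resolve_left hjm) (hQ.pos_lt_of_ne him hib) hjb]

/-- There is an interval `I` ending at `m` and a copy of `thin k I` that splits off from the
restriction of `V` to the vertices up to `m`, whose vector at `m` lies in `B` and whose functional
at `m` vanishes on `A`. The pair `A ≤ B` carries the information about the vertices beyond `m` in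
the induction that constructs an interval summand. -/
def HasIntervalSplitting (V : QuiverRep k Q) (pos : Q → ℕ) (m : Q)
    (A B : Submodule k (V.space m)) : Prop :=
  ∃ a, IsOccupied pos (a, pos m) ∧ ∃ x ξ,
    PartialSplitting V pos (pos m + 1) (interval pos (a, pos m)) x ξ ∧
      x m ∈ B ∧ A ≤ LinearMap.ker (ξ m)

theorem IsLinear.hasIntervalSplitting_of_notMem (hQ : IsLinear Q pos dir) {V : QuiverRep k Q}
    {m : Q} {A B C : Submodule k (V.space m)} {y : V.space m} (hyB : y ∈ B) (hyC : y ∉ C)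
    (hAC : A ≤ C)
    (hin : ∀ {p : Q} (α : p ⟶ m), pos p < pos m → LinearMap.range (V.map α) ≤ C)
    (hout : ∀ {p : Q} (α : m ⟶ p), pos p < pos m → V.map α y = 0) :
    HasIntervalSplitting V pos m A B := by
  classical
  obtain ⟨η, hηy, hηC⟩ := exists_dual_apply_eq_one hyC
  have hm : insert m ∅ = interval pos (pos m, pos m) := by
    rw [insert_empty_eq, interval, Set.Icc_self, ← Set.image_singleton (f := pos) (a := m),
      hQ.pos_injective.preimage_image]
  have h := (PartialSplitting.empty V pos (pos m)).update hQ hηy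
    (fun α hp => ⟨fun hp => hp.elim, LinearMap.ext fun z => hηC (hin α hp ⟨z, rfl⟩)⟩)
    (fun α hp => ⟨hout α hp, fun hp => hp.elim⟩)
  rw [hm] at h
  refine ⟨pos m, ⟨le_rfl, fun e he => ⟨m, le_antisymm he.1 he.2⟩⟩, _, _, h, ?_, ?_⟩
  · rwa [Function.update_self]
  · rw [Function.update_self]
    exact hAC.trans hηC

theorem IsLinear.insert_interval (hQ : IsLinear Q pos dir) {p m : Q} (hpm : pos m = pos p + 1)
    {a : ℕ} (ha : a ≤ pos p) : insert m (interval pos (a, pos p)) = interval pos (a, pos m) := by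
  ext i
  simp only [Set.mem_insert_iff, ← hQ.pos_injective.eq_iff (b := m), interval, Set.mem_preimage,
    Set.mem_Icc]
  omega

theorem IsLinear.eq_of_hom_of_lt (hQ : IsLinear Q pos dir) {i p m : Q} (hpm : pos m = pos p + 1)
    (h : Nonempty (i ⟶ m) ∨ Nonempty (m ⟶ i)) (hi : pos i < pos m) : i = p := by
  apply hQ.pos_injective
  rcases h with ⟨⟨α⟩⟩ | ⟨⟨α⟩⟩ <;> have := hQ.pos_eq_of_hom α <;> omega

theorem IsLinear.hasIntervalSplitting_of_extends (hQ : IsLinear Q pos dir) {V : QuiverRep k Q}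
    {p m : Q} (hpm : pos m = pos p + 1) {a : ℕ} (ha : IsOccupied pos (a, pos p))
    {x : ∀ i, V.space i} {ξ : ∀ i, Module.Dual k (V.space i)}
    (h : PartialSplitting V pos (pos p + 1) (interval pos (a, pos p)) x ξ)
    {A B : Submodule k (V.space m)} {y : V.space m} {η : Module.Dual k (V.space m)}
    (hy : y ∈ B) (hη : A ≤ LinearMap.ker η) (hηy : η y = 1)
    (hin : ∀ α : p ⟶ m, V.map α (x p) = y ∧ η ∘ₗ V.map α = ξ p)
    (hout : ∀ α : m ⟶ p, V.map α y = x p ∧ ξ p ∘ₗ V.map α = η) :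
    HasIntervalSplitting V pos m A B := by
  classical
  have h := PartialSplitting.update hQ (hpm ▸ h) hηy
    (fun α hq => by
      obtain rfl := hQ.eq_of_hom_of_lt hpm (Or.inl ⟨α⟩) hq
      exact (hin α).imp_left fun h _ => h)
    (fun α hq => by
      obtain rfl := hQ.eq_of_hom_of_lt hpm (Or.inr ⟨α⟩) hq
      exact (hout α).imp_right fun h _ => h)
  rw [hQ.insert_interval hpm ha.1] at h
  refine ⟨a, ⟨by have := ha.1; omega, fun e he => ?_⟩, _, _, h, ?_, ?_⟩
  · rcases he.2.lt_or_eq with hlt | rfl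
    · exact ha.2 e ⟨he.1, by omega⟩
    · exact ⟨m, rfl⟩
  · rwa [Function.update_self]
  · rwa [Function.update_self]

theorem IsLinear.hasIntervalSplitting_of_comap (hQ : IsLinear Q pos dir) {V : QuiverRep k Q}
    {p m : Q} (hpm : pos m = pos p + 1) (f : p ⟶ m) {A B : Submodule k (V.space m)}
    (h : HasIntervalSplitting V pos p (A.comap (V.map f)) (B.comap (V.map f))) :
    HasIntervalSplitting V pos m A B := by
  obtain ⟨a, ha, x, ξ, hS, hxB, hξA⟩ := h
  obtain ⟨η, hη, hηA⟩ := exists_dual_comp_eq (V.map f) hξA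
  refine hQ.hasIntervalSplitting_of_extends hpm ha hS hxB hηA ?_ (fun α => ?_) (fun α => ?_)
  · rw [← LinearMap.comp_apply, hη]
    exact hS.dual_apply_vec p ⟨ha.1, le_rfl⟩
  · rw [(hQ.subsingleton_hom p m).elim α f]
    exact ⟨rfl, hη⟩
  · exact (hQ.isEmpty_hom_of_hom f).elim α

theorem IsLinear.hasIntervalSplitting_of_map (hQ : IsLinear Q pos dir) {V : QuiverRep k Q}
    {p m : Q} (hpm : pos m = pos p + 1) (g : m ⟶ p) {A B : Submodule k (V.space m)}
    (h : HasIntervalSplitting V pos p (A.map (V.map g)) (B.map (V.map g))) :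
    HasIntervalSplitting V pos m A B := by
  obtain ⟨a, ha, x, ξ, hS, ⟨y, hyB, hy⟩, hξA⟩ := h
  refine hQ.hasIntervalSplitting_of_extends hpm ha hS hyB
    (LinearMap.ker_comp (V.map g) (ξ p) ▸ Submodule.map_le_iff_le_comap.1 hξA) ?_
    (fun α => ?_) (fun α => ?_)
  · rw [LinearMap.comp_apply, hy]
    exact hS.dual_apply_vec p ⟨ha.1, le_rfl⟩
  · exact (hQ.isEmpty_hom_of_hom g).elim α
  · rw [(hQ.subsingleton_hom m p).elim α g]
    exact ⟨hy, rfl⟩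

theorem IsLinear.exists_hasIntervalSplitting (hQ : IsLinear Q pos dir) (V : QuiverRep k Q)
    (m : Q) {A B : Submodule k (V.space m)} (hle : A ≤ B) (hAB : ¬ B ≤ A) :
    HasIntervalSplitting V pos m A B := by
  induction hn : pos m using Nat.strong_induction_on generalizing m with
  | _ n ih =>
    subst hn
    by_cases hp : ∃ p, pos m = pos p + 1
    · obtain ⟨p, hpm⟩ := hp
      have ih := fun {A B} => ih (pos p) (by omega) p (A := A) (B := B)
      cases hdir : dir (pos p) with
      | true =>
        obtain ⟨f⟩ := hQ.hom_right hpm hdir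
        by_cases hB : B ≤ A ⊔ LinearMap.range (V.map f)
        · exact hQ.hasIntervalSplitting_of_comap hpm f
            (ih (Submodule.comap_mono hle) (not_comap_le_comap _ hle hAB hB) rfl)
        obtain ⟨y, hyB, hy⟩ := Set.not_subset.1 hB
        refine hQ.hasIntervalSplitting_of_notMem hyB hy le_sup_left (fun α hq => ?_)
          (fun α hq => ?_)
        · obtain rfl := hQ.eq_of_hom_of_lt hpm (Or.inl ⟨α⟩) hq
          rw [(hQ.subsingleton_hom _ _).elim α f]
          exact le_sup_right
        · obtain rfl := hQ.eq_of_hom_of_lt hpm (Or.inr ⟨α⟩) hq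
          exact (hQ.isEmpty_hom_of_hom f).elim α
      | false =>
        obtain ⟨g⟩ := hQ.hom_left hpm hdir
        by_cases hB : B ⊓ LinearMap.ker (V.map g) ≤ A
        · exact hQ.hasIntervalSplitting_of_map hpm g
            (ih (Submodule.map_mono hle) (not_map_le_map _ hle hAB hB) rfl)
        obtain ⟨y, ⟨hyB, hyg⟩, hy⟩ := Set.not_subset.1 hB
        refine hQ.hasIntervalSplitting_of_notMem hyB hy le_rfl (fun α hq => ?_) (fun α hq => ?_)
        · obtain rfl := hQ.eq_of_hom_of_lt hpm (Or.inl ⟨α⟩) hq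
          exact (hQ.isEmpty_hom_of_hom g).elim α
        · obtain rfl := hQ.eq_of_hom_of_lt hpm (Or.inr ⟨α⟩) hq
          rw [(hQ.subsingleton_hom _ _).elim α g]
          exact hyg
    · obtain ⟨y, hyB, hy⟩ := Set.not_subset.1 hAB
      have hno : ∀ {q : Q}, pos q < pos m → pos m ≠ pos q + 1 := fun _ h => hp ⟨_, h⟩
      exact hQ.hasIntervalSplitting_of_notMem hyB hy le_rfl
        (fun α hq => by have := hQ.pos_eq_of_hom α; have := hno hq; omega)
        (fun α hq => by have := hQ.pos_eq_of_hom α; have := hno hq; omega)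

theorem IsLinear.exists_isSummand_thin [Finite Q] (hQ : IsLinear Q pos dir) {V : QuiverRep k Q}
    (hV : ¬ V.IsZero) :
    ∃ p, IsOccupied pos p ∧ (thin k (interval pos p)).IsSummand V := by
  have hne : {i | ¬ Subsingleton (V.space i)}.Nonempty := by
    simpa [IsZero, Set.Nonempty] using hV
  obtain ⟨m, hm, hmax⟩ := Set.exists_max_image _ pos (Set.toFinite _) hne
  have hzero : ∀ i, ¬ pos i < pos m + 1 → Subsingleton (V.space i) := fun i hi => by
    by_contra h
    have := hmax i h
    omega
  have hm : ¬ (⊤ : Submodule k (V.space m)) ≤ ⊥ := fun h => hm ⟨fun y z =>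
    ((Submodule.mem_bot k).1 (h trivial)).trans ((Submodule.mem_bot k).1 (h trivial)).symm⟩
  obtain ⟨a, ha, x, ξ, h, -, -⟩ := hQ.exists_hasIntervalSplitting V m bot_le hm
  refine ⟨(a, pos m), ha, isSummand_thin x ξ h.vec_eq_zero h.dual_eq_zero h.dual_apply_vec
    (fun {i j} α hi => ?_) (fun {i j} α hj => ?_)⟩
  · by_cases hj : pos j < pos m + 1
    · exact h.map_vec α hi (Nat.lt_succ_of_le hi.2) hj
    · exact (hzero j hj).elim _ _
  · by_cases hi : pos i < pos m + 1
    · exact h.dual_comp_map α hj hi (Nat.lt_succ_of_le hj.2)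
    · have := hzero i hi
      exact Subsingleton.elim _ _

theorem IsLinear.exists_isIsomorphic_thin [Finite Q] (hQ : IsLinear Q pos dir)
    {V : QuiverRep k Q} (hV : V.IsIndecomposable) :
    ∃ p, IsOccupied pos p ∧ IsIsomorphic V (thin k (interval pos p)) := by
  obtain ⟨p, hp, K, hK⟩ := hQ.exists_isSummand_thin hV.1
  have hK0 : K.IsZero := (hV.2 _ _ hK).resolve_left (not_isZero_thin hp.nonempty)
  exact ⟨p, hp, hK.trans (isIsomorphic_prod_of_isZero hK0)⟩

end Splitting

section Compatible

/-- An obstruction to `Ext¹(M_p, M_q) = 0` for the interval representations of `p` and `q`: a walk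
from `c` to `m + 1` all of whose arrows start in `p` and end in `q`, while its ends do not lie in
both intervals. -/
def Obstructs (dir : ℕ → Bool) (p q : ℕ × ℕ) : Prop :=
  ∃ c m, c ≤ m ∧ c ∉ Set.Icc p.1 p.2 ∩ Set.Icc q.1 q.2 ∧
    m + 1 ∉ Set.Icc p.1 p.2 ∩ Set.Icc q.1 q.2 ∧
    ∀ e ∈ Set.Icc c m, (dir e = true ∧ e ∈ Set.Icc p.1 p.2 ∧ e + 1 ∈ Set.Icc q.1 q.2) ∨
      (dir e = false ∧ e + 1 ∈ Set.Icc p.1 p.2 ∧ e ∈ Set.Icc q.1 q.2)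

/-- The combinatorial counterpart of the vanishing of `Ext¹` between two interval representations
in both directions. -/
def Compatible (dir : ℕ → Bool) (p q : ℕ × ℕ) : Prop :=
  ¬ Obstructs dir p q ∧ ¬ Obstructs dir q p

theorem exists_sub_eq_of_surjective_extMap {I J : Set Q}
    (h : Function.Surjective (extMap (thin k I) (thin k J))) (g : Q → Q → k) :
    ∃ x : Q → k, (∀ i ∉ I ∩ J, x i = 0) ∧
      ∀ {i j : Q}, (i ⟶ j) → i ∈ I → j ∈ J → x j - x i = g i j := by
  obtain ⟨f, hf⟩ := h fun i j _ =>
    LinearMap.toSpanSingleton k _ (g i j • thinOne k J j) ∘ₗ thinCoord k I i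
  let x : Q → k := fun i => thinCoord k J i (f i (thinOne k I i))
  have hx : ∀ i ∉ I ∩ J, x i = 0 := fun i hi => by
    rcases not_and_or.1 hi with hI | hJ
    · simp only [x, thinOne_of_notMem hI, map_zero]
    · exact thinCoord_of_notMem hJ _
  refine ⟨x, hx, fun {i j} α hi hj => ?_⟩
  have hij := congrArg (thinCoord k J j)
    (LinearMap.congr_fun (congrFun₃ hf i j α) (thinOne k I i))
  rw [extMap_apply, map_thinOne hi, map_sub, thinCoord_map, if_pos hj, LinearMap.comp_apply,
    thinCoord_thinOne hi, LinearMap.toSpanSingleton_apply, one_smul, map_smul,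
    thinCoord_thinOne hj, smul_eq_mul, mul_one] at hij
  exact hij

/- Along the walk the equations `x j - x i = g i j` determine the increments of `x`, which vanishes
at both ends, so the values of `g` cannot be prescribed arbitrarily. -/
theorem IsLinear.not_obstructs_of_surjective_extMap (hQ : IsLinear Q pos dir) {p q : ℕ × ℕ}
    (hp : IsOccupied pos p) (hq : IsOccupied pos q)
    (h : Function.Surjective (extMap (thin k (interval pos p)) (thin k (interval pos q)))) :
    ¬ Obstructs dir p q := by
  classical
  rintro ⟨c, m, hcm, hc, hm, hwalk⟩
  obtain ⟨x, hx₀, hx⟩ := exists_sub_eq_of_surjective_extMap h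
    fun i j : Q => if min (pos i) (pos j) = c then 1 else 0
  let y : ℕ → k := Function.extend pos x 0
  have hy : ∀ i, y (pos i) = x i := hQ.pos_injective.extend_apply x 0
  have hy₀ : ∀ e ∉ Set.Icc p.1 p.2 ∩ Set.Icc q.1 q.2, y e = 0 := fun e he => by
    by_cases hi : ∃ i, pos i = e
    · obtain ⟨i, rfl⟩ := hi
      rw [hy, hx₀ i he]
    · exact (Function.extend_apply' x (0 : ℕ → k) e hi).trans rfl
  have hstep : ∀ e ∈ Set.Icc c m, (y (e + 1) = y e ↔ e ≠ c) := fun e he => by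
    rcases hwalk e he with ⟨hdir, hep, heq⟩ | ⟨hdir, hep, heq⟩ <;>
      obtain ⟨i, hi⟩ := hp.2 _ hep <;> obtain ⟨j, hj⟩ := hq.2 _ heq
    · obtain ⟨α⟩ := hQ.hom_right (hj.trans (congrArg (· + 1) hi.symm)) (hi ▸ hdir)
      have hij := hx α (hi ▸ hep : pos i ∈ _) (hj ▸ heq : pos j ∈ _)
      rw [← hy, ← hy, hj, hi, min_eq_left e.le_succ] at hij
      rw [← sub_eq_zero, hij]
      simp
    · obtain ⟨α⟩ := hQ.hom_left (hi.trans (congrArg (· + 1) hj.symm)) (hj ▸ hdir)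
      have hij := hx α (hi ▸ hep : pos i ∈ _) (hj ▸ heq : pos j ∈ _)
      rw [← hy, ← hy, hj, hi, min_eq_right e.le_succ] at hij
      rw [eq_comm, ← sub_eq_zero, hij]
      simp
  have hconst : ∀ e, c + 1 ≤ e → e ≤ m + 1 → y e = y (c + 1) := fun e he => by
    induction e, he using Nat.le_induction with
    | base => exact fun _ => rfl
    | succ e he ih =>
      exact fun hem => ((hstep e ⟨by omega, by omega⟩).2 (by omega)).trans (ih (by omega))
  refine (hstep c ⟨le_rfl, hcm⟩).1 ?_ rfl
  rw [← hconst (m + 1) (by omega) le_rfl, hy₀ _ hm, hy₀ _ hc]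

theorem IsRigid.compatible {V : QuiverRep k Q} (hV : V.IsRigid) (hQ : IsLinear Q pos dir)
    {p q : ℕ × ℕ} (hp : IsOccupied pos p) (hq : IsOccupied pos q)
    (hpV : (thin k (interval pos p)).IsSummand V) (hqV : (thin k (interval pos q)).IsSummand V) :
    Compatible dir p q := by
  have h := isRigid_iff_surjective_extMap.1 hV
  exact ⟨hQ.not_obstructs_of_surjective_extMap hp hq (hpV.surjective_extMap hqV h),
    hQ.not_obstructs_of_surjective_extMap hq hp (hqV.surjective_extMap hpV h)⟩

theorem Compatible.dir_ne_of_crossing {a c m d : ℕ} (h : Compatible dir (a, m) (c + 1, d))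
    (hac : a ≤ c) (hcm : c ≤ m) (hmd : m < d) : dir c ≠ dir m := by
  intro hdir
  cases hc : dir c with
  | true =>
    refine h.1 ⟨c, m, hcm, by simp, by simp, fun e he => ?_⟩
    have hne : dir e = false → e ≠ c ∧ e ≠ m := by grind
    simp only [Set.mem_Icc] at he ⊢
    grind
  | false =>
    refine h.2 ⟨c, m, hcm, by simp, by simp, fun e he => ?_⟩
    have hne : dir e = true → e ≠ c ∧ e ≠ m := by grind
    simp only [Set.mem_Icc] at he ⊢
    grind

theorem Compatible.dir_eq_of_nested {a c m d : ℕ} (h : Compatible dir (a, d) (c + 1, m))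
    (hac : a ≤ c) (hcm : c < m) (hmd : m < d) : dir c = dir m := by
  by_contra hdir
  cases hc : dir c with
  | true =>
    refine h.1 ⟨c, m, hcm.le, by simp, by simp, fun e he => ?_⟩
    have hne : (dir e = false → e ≠ c) ∧ (dir e = true → e ≠ m) := by grind
    simp only [Set.mem_Icc] at he ⊢
    grind
  | false =>
    refine h.2 ⟨c, m, hcm.le, by simp, by simp, fun e he => ?_⟩
    have hne : (dir e = true → e ≠ c) ∧ (dir e = false → e ≠ m) := by grind
    simp only [Set.mem_Icc] at he ⊢
    grind

end Compatible

end QuiverRep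

open scoped NNReal

section SimplicialFan

variable {κ κ' E Q : Type*}

/-- The cones spanned by the families `vec` restricted to `S`, for `S ∈ 𝒟`, form a simplicial fan:
every vector has at most one representation as a nonnegative combination of a subfamily indexed by
a member of `𝒟`. -/
def IsSimplicialFan [AddCommGroup E] [Module ℝ E] (vec : κ → E) (𝒟 : Set (Set κ)) : Prop :=
  Set.InjOn (Finsupp.linearCombination ℝ≥0 vec) {w | ∃ S ∈ 𝒟, (w.support : Set κ) ⊆ S}

section Module

variable [AddCommGroup E] [Module ℝ E] {vec : κ → E} {𝒟 : Set (Set κ)} {S S' : Set κ}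

theorem exists_linearCombination_eq_of_mem_convexHull {x : E}
    (hx : x ∈ convexHull ℝ ({0} ∪ vec '' S)) :
    ∃ w : κ →₀ ℝ≥0, (w.support : Set κ) ⊆ S ∧ Finsupp.linearCombination ℝ≥0 vec w = x := by
  have hspan : x ∈ Submodule.span ℝ≥0 (vec '' S) := by
    refine convexHull_min ?_ (PointedCone.convex (Submodule.span ℝ≥0 (vec '' S))) hx
    exact Set.union_subset (Set.singleton_subset_iff.2 (zero_mem _)) Submodule.subset_span
  exact (Finsupp.mem_span_image_iff_linearCombination ℝ≥0).1 hspan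

theorem linearCombination_toNNReal_sub (l : κ →₀ ℝ) :
    Finsupp.linearCombination ℝ≥0 vec (l.mapRange Real.toNNReal Real.toNNReal_zero) -
        Finsupp.linearCombination ℝ≥0 vec ((-l).mapRange Real.toNNReal Real.toNNReal_zero) =
      Finsupp.linearCombination ℝ vec l := by
  simp only [Finsupp.linearCombination_apply]
  rw [Finsupp.sum_mapRange_index (by simp), Finsupp.sum_mapRange_index (by simp),
    Finsupp.sum_neg_index (by simp), Finsupp.sum, Finsupp.sum, ← Finset.sum_sub_distrib]
  refine Finset.sum_congr rfl fun q _ => ?_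
  rw [NNReal.smul_def, NNReal.smul_def, ← sub_smul, Real.coe_toNNReal', Real.coe_toNNReal',
    max_zero_sub_max_neg_zero_eq_self]

namespace IsSimplicialFan

theorem linearIndepOn (h : IsSimplicialFan vec 𝒟) (hS : S ∈ 𝒟) : LinearIndepOn ℝ vec S := by
  rw [linearIndepOn_iff]
  intro l hl hl₀
  have hsub : ∀ l' : κ →₀ ℝ, l'.support = l.support →
      ((l'.mapRange Real.toNNReal Real.toNNReal_zero).support : Set κ) ⊆ S := fun l' hl' =>
    (Finset.coe_subset.2 (hl' ▸ Finsupp.support_mapRange)).trans hl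
  have hparts := h ⟨S, hS, hsub l rfl⟩ ⟨S, hS, hsub (-l) (Finsupp.support_neg l)⟩
    (sub_eq_zero.1 ((linearCombination_toNNReal_sub l).trans hl₀))
  ext q
  have hq : (l q).toNNReal = (-l q).toNNReal := DFunLike.congr_fun hparts q
  rw [← max_zero_sub_max_neg_zero_eq_self (l q), ← Real.coe_toNNReal', ← Real.coe_toNNReal', hq,
    sub_self, Finsupp.zero_apply]

theorem inter_convexHull_subset (h : IsSimplicialFan vec 𝒟) (hS : S ∈ 𝒟) (hS' : S' ∈ 𝒟) :
    convexHull ℝ ({0} ∪ vec '' S) ∩ convexHull ℝ ({0} ∪ vec '' S') ⊆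
      Submodule.span ℝ (vec '' (S ∩ S')) := by
  rintro x ⟨hx, hx'⟩
  obtain ⟨w, hw, rfl⟩ := exists_linearCombination_eq_of_mem_convexHull hx
  obtain ⟨w', hw', heq⟩ := exists_linearCombination_eq_of_mem_convexHull hx'
  obtain rfl := h ⟨S', hS', hw'⟩ ⟨S, hS, hw⟩ heq
  exact Submodule.span_subset_span ℝ≥0 ℝ _
    ((Finsupp.mem_span_image_iff_linearCombination ℝ≥0).2 ⟨w', Set.subset_inter hw hw', rfl⟩)

end IsSimplicialFan

end Module

theorem IsSimplicialFan.volume_inter_convexHull [Fintype Q] {vec : κ → Q → ℝ} {𝒟 : Set (Set κ)}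
    (h : IsSimplicialFan vec 𝒟) {S S' : Set κ} (hS : S ∈ 𝒟) (hS' : S' ∈ 𝒟) (hne : S ≠ S') :
    volume (convexHull ℝ ({0} ∪ vec '' S) ∩ convexHull ℝ ({0} ∪ vec '' S')) = 0 := by
  wlog hsub : ¬ S ⊆ S' generalizing S S'
  · rw [Set.inter_comm]
    exact this hS' hS hne.symm fun hsub' => hne ((not_not.1 hsub).antisymm hsub')
  obtain ⟨q, hq, hq'⟩ := Set.not_subset.1 hsub
  refine measure_mono_null (h.inter_convexHull_subset hS hS')
    (Measure.addHaar_submodule volume _ fun htop => ?_)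
  refine linearIndepOn_iff_notMem_span.1 (h.linearIndepOn hS) q hq ?_
  refine Submodule.span_mono (Set.image_mono fun p hp => ?_)
    (htop ▸ Submodule.mem_top : vec q ∈ Submodule.span ℝ (vec '' (S ∩ S')))
  exact ⟨hp.1, fun hpq => hq' (hpq ▸ hp.2)⟩

section SignedJoin

variable {vec : κ → Q → ℝ} {vec' : κ' → Q → ℝ} {𝒟 : Set (Set κ)} {ℰ : Set (Set κ')}

/-- The index sets `S ⊔ S'` with `S ∈ 𝒟` and `S' ∈ ℰ` such that the members of `vec` on `S` and
the members of `vec'` on `S'` have disjoint supports. -/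
def signedJoin (vec : κ → Q → ℝ) (vec' : κ' → Q → ℝ) (𝒟 : Set (Set κ)) (ℰ : Set (Set κ')) :
    Set (Set (κ ⊕ κ')) :=
  {S | Sum.inl ⁻¹' S ∈ 𝒟 ∧ Sum.inr ⁻¹' S ∈ ℰ ∧ ∀ a b, Sum.inl a ∈ S → Sum.inr b ∈ S →
    Disjoint (Function.support (vec a)) (Function.support (vec' b))}

theorem linearCombination_sumElim_neg (w : κ ⊕ κ' →₀ ℝ≥0) :
    Finsupp.linearCombination ℝ≥0 (Sum.elim vec (-vec')) w =
      Finsupp.linearCombination ℝ≥0 vec (Finsupp.sumFinsuppLEquivProdFinsupp ℝ≥0 w).1 -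
        Finsupp.linearCombination ℝ≥0 vec' (Finsupp.sumFinsuppLEquivProdFinsupp ℝ≥0 w).2 := by
  induction w using Finsupp.induction_linear with
  | zero => simp only [map_zero, Prod.fst_zero, Prod.snd_zero, sub_zero]
  | add w w' hw hw' => simp only [map_add, Prod.fst_add, Prod.snd_add, hw, hw', add_sub_add_comm]
  | single q r => cases q <;> ext i <;> simp

theorem exists_ne_zero_of_linearCombination_apply_ne_zero {w : κ →₀ ℝ≥0} {i : Q}
    (h : Finsupp.linearCombination ℝ≥0 vec w i ≠ 0) : ∃ q ∈ w.support, vec q i ≠ 0 := by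
  rw [Finsupp.linearCombination_apply, Finsupp.sum, Finset.sum_apply] at h
  obtain ⟨q, hq, hqi⟩ := Finset.exists_ne_zero_of_sum_ne_zero h
  exact ⟨q, hq, right_ne_zero_of_smul (M := ℝ≥0) hqi⟩

theorem linearCombination_nonneg (hvec : 0 ≤ vec) (w : κ →₀ ℝ≥0) :
    0 ≤ Finsupp.linearCombination ℝ≥0 vec w :=
  Finset.sum_nonneg fun q _ => smul_nonneg zero_le (hvec q)

theorem posPart_sub_eq_of_disjoint_support {f g : Q → ℝ} (hf : 0 ≤ f) (hg : 0 ≤ g)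
    (h : Disjoint (Function.support f) (Function.support g)) : (f - g)⁺ = f := by
  ext i
  rw [Pi.posPart_apply, Pi.sub_apply]
  by_cases hi : f i = 0
  · rw [hi, posPart_eq_zero, zero_sub, neg_nonpos]
    exact hg i
  · rw [Function.notMem_support.1 (Set.disjoint_left.1 h hi), sub_zero, posPart_eq_self]
    exact hf i

theorem disjoint_support_of_mem_signedJoin {w : κ ⊕ κ' →₀ ℝ≥0} {S : Set (κ ⊕ κ')}
    (hS : S ∈ signedJoin vec vec' 𝒟 ℰ) (hw : (w.support : Set (κ ⊕ κ')) ⊆ S) :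
    Disjoint
      (Function.support (Finsupp.linearCombination ℝ≥0 vec
        (Finsupp.sumFinsuppLEquivProdFinsupp ℝ≥0 w).1))
      (Function.support (Finsupp.linearCombination ℝ≥0 vec'
        (Finsupp.sumFinsuppLEquivProdFinsupp ℝ≥0 w).2)) := by
  refine Set.disjoint_left.2 fun i hi hi' => ?_
  obtain ⟨a, ha, hai⟩ := exists_ne_zero_of_linearCombination_apply_ne_zero hi
  obtain ⟨b, hb, hbi⟩ := exists_ne_zero_of_linearCombination_apply_ne_zero hi'
  rw [Finsupp.mem_support_iff, Finsupp.fst_sumFinsuppLEquivProdFinsupp,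
    ← Finsupp.mem_support_iff] at ha
  rw [Finsupp.mem_support_iff, Finsupp.snd_sumFinsuppLEquivProdFinsupp,
    ← Finsupp.mem_support_iff] at hb
  exact Set.disjoint_left.1 (hS.2.2 a b (hw ha) (hw hb)) hai hbi

theorem IsSimplicialFan.signedJoin (h : IsSimplicialFan vec 𝒟) (h' : IsSimplicialFan vec' ℰ)
    (hvec : 0 ≤ vec) (hvec' : 0 ≤ vec') :
    IsSimplicialFan (Sum.elim vec (-vec')) (signedJoin vec vec' 𝒟 ℰ) := by
  rintro w ⟨S, hS, hw⟩ w' ⟨S', hS', hw'⟩ heq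
  rw [linearCombination_sumElim_neg, linearCombination_sumElim_neg] at heq
  have hfst := congrArg (·⁺) heq
  have hsnd := congrArg (fun x => (-x)⁺) heq
  simp only [neg_sub] at hsnd
  have hdisj := disjoint_support_of_mem_signedJoin hS hw
  have hdisj' := disjoint_support_of_mem_signedJoin hS' hw'
  have hpos := linearCombination_nonneg hvec
  have hpos' := linearCombination_nonneg hvec'
  rw [posPart_sub_eq_of_disjoint_support (hpos _) (hpos' _) hdisj,
    posPart_sub_eq_of_disjoint_support (hpos _) (hpos' _) hdisj'] at hfst
  rw [posPart_sub_eq_of_disjoint_support (hpos' _) (hpos _) hdisj.symm,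
    posPart_sub_eq_of_disjoint_support (hpos' _) (hpos _) hdisj'.symm] at hsnd
  refine (Finsupp.sumFinsuppLEquivProdFinsupp ℝ≥0).injective (Prod.ext ?_ ?_)
  · exact h ⟨_, hS.1, fun a ha => hw (by simpa using ha)⟩
      ⟨_, hS'.1, fun a ha => hw' (by simpa using ha)⟩ hfst
  · exact h' ⟨_, hS.2.1, fun b hb => hw (by simpa using hb)⟩
      ⟨_, hS'.2.1, fun b hb => hw' (by simpa using hb)⟩ hsnd

end SignedJoin

theorem isSimplicialFan_single [DecidableEq Q] (𝒟 : Set (Set Q)) :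
    IsSimplicialFan (fun j : Q => (Pi.single j 1 : Q → ℝ)) 𝒟 :=
  ((Pi.linearIndependent_single_one Q ℝ).restrict_scalars (R := ℝ≥0) (by
    simpa only [NNReal.smul_def, smul_eq_mul, mul_one] using NNReal.coe_injective)).injOn

end SimplicialFan

namespace QuiverRep

section IntervalFan

variable {Q : Type*} {pos : Q → ℕ} {dir : ℕ → Bool}

/-- The dimension vector of the interval representation of `p`. -/
noncomputable def intervalVec (pos : Q → ℕ) (p : ℕ × ℕ) : Q → ℝ :=
  (interval pos p).indicator 1

theorem support_intervalVec (pos : Q → ℕ) (q : ℕ × ℕ) :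
    Function.support (intervalVec pos q) = interval pos q := by
  rw [intervalVec, Set.support_indicator, Function.support_one, Set.inter_univ]

theorem intervalVec_nonneg : 0 ≤ intervalVec pos := fun _ =>
  Set.indicator_nonneg fun _ _ => zero_le_one

/-- The sets of pairwise compatible occupied intervals. -/
def compatibleSets (pos : Q → ℕ) (dir : ℕ → Bool) : Set (Set (ℕ × ℕ)) :=
  {S | (∀ p ∈ S, IsOccupied pos p) ∧ ∀ p ∈ S, ∀ q ∈ S, Compatible dir p q}

/-- The total weight of the intervals which start at `a` and do not end before `m`. -/
noncomputable def tailWeight (m a : ℕ) : (ℕ × ℕ →₀ ℝ≥0) →ₗ[ℝ≥0] ℝ≥0 :=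
  Finsupp.linearCombination ℝ≥0 fun q => if q.1 = a ∧ m ≤ q.2 then 1 else 0

theorem tailWeight_eq_add (m a : ℕ) (w : ℕ × ℕ →₀ ℝ≥0) :
    tailWeight m a w = w (a, m) + tailWeight (m + 1) a w := by
  induction w using Finsupp.induction_linear with
  | zero => simp only [map_zero, Finsupp.zero_apply, add_zero]
  | add w w' hw hw' => simp only [map_add, hw, hw', Finsupp.add_apply, add_add_add_comm]
  | single q r =>
    simp only [tailWeight, Finsupp.linearCombination_single, smul_eq_mul, mul_ite, mul_one,
      mul_zero, Finsupp.single_apply, Prod.ext_iff]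
    grind

theorem exists_mem_support_of_tailWeight_ne_zero {m a : ℕ} {w : ℕ × ℕ →₀ ℝ≥0}
    (h : tailWeight m a w ≠ 0) : ∃ d, m ≤ d ∧ (a, d) ∈ w.support := by
  obtain ⟨⟨a, d⟩, hq, hne⟩ := Finset.exists_ne_zero_of_sum_ne_zero h
  obtain ⟨rfl, hd⟩ := (ite_ne_right_iff.1 (right_ne_zero_of_smul hne)).1
  exact ⟨d, hd, hq⟩

theorem linearCombination_intervalVec_apply (w : ℕ × ℕ →₀ ℝ≥0) (i : Q) :
    Finsupp.linearCombination ℝ≥0 (intervalVec pos) w i =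
      ∑ a ∈ Finset.range (pos i + 1), (tailWeight (pos i) a w : ℝ) := by
  induction w using Finsupp.induction_linear with
  | zero => simp only [map_zero, Pi.zero_apply, NNReal.coe_zero, Finset.sum_const_zero]
  | add w w' hw hw' =>
    simp only [map_add, Pi.add_apply, hw, hw', NNReal.coe_add, Finset.sum_add_distrib]
  | single q r =>
    classical
    simp only [tailWeight, Finsupp.linearCombination_single, intervalVec, interval,
      Set.indicator_apply, Set.mem_preimage, Set.mem_Icc, Pi.smul_apply, Pi.one_apply,
      NNReal.smul_def, smul_eq_mul, mul_ite, mul_one, mul_zero, ite_and, apply_ite NNReal.toReal,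
      NNReal.coe_zero, Finset.sum_ite_eq, Finset.mem_range, Nat.lt_succ_iff]

theorem sum_tailWeight_eq {w w' : ℕ × ℕ →₀ ℝ≥0} (hw : ∀ p ∈ w.support, IsOccupied pos p)
    (hw' : ∀ p ∈ w'.support, IsOccupied pos p)
    (heq : Finsupp.linearCombination ℝ≥0 (intervalVec pos) w =
      Finsupp.linearCombination ℝ≥0 (intervalVec pos) w') (m : ℕ) :
    ∑ a ∈ Finset.range (m + 1), tailWeight m a w =
      ∑ a ∈ Finset.range (m + 1), tailWeight m a w' := by
  by_cases hm : ∃ i, pos i = m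
  · obtain ⟨i, rfl⟩ := hm
    have hi := congrFun heq i
    rw [linearCombination_intervalVec_apply, linearCombination_intervalVec_apply] at hi
    exact_mod_cast hi
  · have hzero : ∀ u : ℕ × ℕ →₀ ℝ≥0, (∀ p ∈ u.support, IsOccupied pos p) →
        ∀ a ∈ Finset.range (m + 1), tailWeight m a u = 0 := fun u hu a ha => by
      by_contra hne
      obtain ⟨d, hd, hmem⟩ := exists_mem_support_of_tailWeight_ne_zero hne
      exact hm ((hu _ hmem).2 m ⟨Finset.mem_range_succ_iff.1 ha, hd⟩)
    rw [Finset.sum_eq_zero (hzero w hw), Finset.sum_eq_zero (hzero w' hw')]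

/- If the tail weights of `w` and `w'` differed at `a < c` in opposite directions, then `w'` would
contain `(a, m)` and some `(c, d')` with `d' > m`, which cross, while `w` would contain `(c, m)`
and some `(a, d)` with `d > m`, which are nested. Crossing compatible intervals force different
directions before `c` and after `m`, nested ones the same direction. -/
theorem tailWeight_succ_le_of_lt {w w' : ℕ × ℕ →₀ ℝ≥0}
    (hw : ∀ p ∈ w.support, ∀ q ∈ w.support, Compatible dir p q)
    (hw' : ∀ p ∈ w'.support, ∀ q ∈ w'.support, Compatible dir p q) {m : ℕ}
    (heq : ∀ a ≤ m, tailWeight m a w = tailWeight m a w') {a c : ℕ} (hac : a < c) (hcm : c ≤ m + 1)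
    (hlt : tailWeight (m + 1) a w' < tailWeight (m + 1) a w) :
    tailWeight (m + 1) c w' ≤ tailWeight (m + 1) c w := by
  by_contra! hlt'
  have hmem : ∀ {b : ℕ} {u u' : ℕ × ℕ →₀ ℝ≥0}, tailWeight m b u = tailWeight m b u' →
      tailWeight (m + 1) b u' < tailWeight (m + 1) b u → (b, m) ∈ u'.support :=
    fun {b u u'} h hb => by
      rw [Finsupp.mem_support_iff]
      intro h₀
      rw [tailWeight_eq_add, tailWeight_eq_add m b u', h₀, zero_add] at h
      exact hb.not_ge (h ▸ le_add_self)
  obtain ⟨d, hd, had⟩ := exists_mem_support_of_tailWeight_ne_zero hlt.ne_bot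
  obtain ⟨d', hd', hcd⟩ := exists_mem_support_of_tailWeight_ne_zero hlt'.ne_bot
  obtain ⟨c, rfl⟩ := Nat.exists_eq_add_one_of_ne_zero (Nat.ne_zero_of_lt hac)
  have ham := hmem (heq a (by omega)) hlt
  have hne : dir c ≠ dir m :=
    (hw' _ ham _ hcd).dir_ne_of_crossing (by omega) (by omega) (by omega)
  obtain rfl | hcm : c = m ∨ c < m := by omega
  · exact hne rfl
  · exact hne ((hw _ had _ (hmem (heq (c + 1) hcm).symm hlt')).dir_eq_of_nested (by omega) hcm
      (by omega))

theorem tailWeight_succ_le {w w' : ℕ × ℕ →₀ ℝ≥0}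
    (hw : ∀ p ∈ w.support, ∀ q ∈ w.support, Compatible dir p q)
    (hw' : ∀ p ∈ w'.support, ∀ q ∈ w'.support, Compatible dir p q) {m : ℕ}
    (heq : ∀ a ≤ m, tailWeight m a w = tailWeight m a w')
    (hsum : ∑ a ∈ Finset.range (m + 2), tailWeight (m + 1) a w =
      ∑ a ∈ Finset.range (m + 2), tailWeight (m + 1) a w') {a : ℕ} (ha : a ≤ m + 1) :
    tailWeight (m + 1) a w ≤ tailWeight (m + 1) a w' := by
  by_contra! hlt
  obtain ⟨c, hc, hlt'⟩ : ∃ c ∈ Finset.range (m + 2),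
      tailWeight (m + 1) c w < tailWeight (m + 1) c w' := by
    by_contra! hle
    exact (Finset.sum_lt_sum hle ⟨a, Finset.mem_range_succ_iff.2 ha, hlt⟩).ne' hsum
  rcases lt_trichotomy a c with hac | rfl | hca
  · exact hlt'.not_ge
      (tailWeight_succ_le_of_lt hw hw' heq hac (Finset.mem_range_succ_iff.1 hc) hlt)
  · exact lt_asymm hlt hlt'
  · exact hlt.not_ge
      (tailWeight_succ_le_of_lt hw' hw (fun b hb => (heq b hb).symm) hca ha hlt')

theorem tailWeight_eq_of_linearCombination_eq {w w' : ℕ × ℕ →₀ ℝ≥0} {S S' : Set (ℕ × ℕ)}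
    (hS : S ∈ compatibleSets pos dir) (hw : (w.support : Set (ℕ × ℕ)) ⊆ S)
    (hS' : S' ∈ compatibleSets pos dir) (hw' : (w'.support : Set (ℕ × ℕ)) ⊆ S')
    (heq : Finsupp.linearCombination ℝ≥0 (intervalVec pos) w =
      Finsupp.linearCombination ℝ≥0 (intervalVec pos) w') (m : ℕ) :
    ∀ a ≤ m, tailWeight m a w = tailWeight m a w' := by
  have hsum := sum_tailWeight_eq (fun p hp => hS.1 p (hw hp)) (fun p hp => hS'.1 p (hw' hp)) heq
  have hcomp := fun p hp q hq => hS.2 p (hw hp) q (hw hq)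
  have hcomp' := fun p hp q hq => hS'.2 p (hw' hp) q (hw' hq)
  induction m with
  | zero =>
    intro a ha
    obtain rfl := Nat.le_zero.1 ha
    simpa only [zero_add, Finset.sum_range_one] using hsum 0
  | succ m ih =>
    exact fun a ha => le_antisymm (tailWeight_succ_le hcomp hcomp' ih (hsum (m + 1)) ha)
      (tailWeight_succ_le hcomp' hcomp (fun b hb => (ih b hb).symm) (hsum (m + 1)).symm ha)

theorem isSimplicialFan_compatibleSets (pos : Q → ℕ) (dir : ℕ → Bool) :
    IsSimplicialFan (intervalVec pos) (compatibleSets pos dir) := by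
  rintro w ⟨S, hS, hw⟩ w' ⟨S', hS', hw'⟩ heq
  have htail := tailWeight_eq_of_linearCombination_eq hS hw hS' hw' heq
  ext1 ⟨a, m⟩
  rcases le_or_gt a m with ham | hma
  · have h := htail m a ham
    rwa [tailWeight_eq_add, tailWeight_eq_add m a w', htail (m + 1) a (by omega),
      add_left_inj] at h
  · rw [Finsupp.notMem_support_iff.1 fun h => hma.not_ge (hS.1 _ (hw h)).1,
      Finsupp.notMem_support_iff.1 fun h => hma.not_ge (hS'.1 _ (hw' h)).1]

end IntervalFan

end QuiverRep

section SimplexVolume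

/-- The corner of the positive orthant of `ℝ^ι` cut off by the hyperplane `∑ i, x i = r`. -/
def orthantCorner (ι : Type*) [Fintype ι] (r : ℝ) : Set (ι → ℝ) :=
  {x | 0 ≤ x ∧ ∑ i, x i ≤ r}

variable {ι : Type*} [Fintype ι]

theorem convex_orthantCorner (r : ℝ) : Convex ℝ (orthantCorner ι r) :=
  (convex_Ici 0).inter ((convex_Iic r).is_linear_preimage
    (f := fun x : ι → ℝ => ∑ i, x i) ⟨fun _ _ => Finset.sum_add_distrib,
      fun c x => (Finset.mul_sum Finset.univ x c).symm⟩)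

theorem isClosed_orthantCorner (r : ℝ) : IsClosed (orthantCorner ι r) :=
  isClosed_Ici.inter (isClosed_le (continuous_finsetSum _ fun i _ => continuous_apply i)
    continuous_const)

theorem convexHull_zero_union_range_single [DecidableEq ι] :
    convexHull ℝ ({0} ∪ Set.range fun i : ι => (Pi.single i 1 : ι → ℝ)) = orthantCorner ι 1 := by
  refine (convexHull_min ?_ (convex_orthantCorner 1)).antisymm fun x hx => ?_
  · rintro x (rfl | ⟨i, rfl⟩)
    · exact ⟨le_rfl, by simp⟩
    · exact ⟨Pi.single_nonneg.2 zero_le_one, by simp⟩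
  · refine mem_convexHull_of_exists_fintype (Option.elim · (1 - ∑ i, x i) x)
      (Option.elim · 0 fun i => Pi.single i 1) ?_ ?_ ?_ ?_
    · exact Option.rec (sub_nonneg.2 hx.2) hx.1
    · rw [Fintype.sum_option]
      exact sub_add_cancel 1 _
    · exact Option.rec (Or.inl rfl) fun i => Or.inr ⟨i, rfl⟩
    · rw [Fintype.sum_option]
      exact (congrArg₂ (· + ·) (smul_zero _) (pi_eq_sum_univ' x).symm).trans (zero_add x)

theorem cons_mem_orthantCorner {n : ℕ} {r t : ℝ} {y : Fin n → ℝ} :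
    (Fin.cons t y : Fin (n + 1) → ℝ) ∈ orthantCorner (Fin (n + 1)) r ↔
      0 ≤ t ∧ y ∈ orthantCorner (Fin n) (r - t) := by
  simp only [orthantCorner, Set.mem_ofPred_eq, Pi.le_def, Fin.forall_fin_succ, Fin.sum_univ_succ,
    Pi.zero_apply, Fin.cons_zero, Fin.cons_succ, and_assoc, le_sub_iff_add_le']

theorem orthantCorner_eq_empty {r : ℝ} (hr : r < 0) : orthantCorner ι r = ∅ :=
  Set.eq_empty_of_forall_notMem fun _ hx =>
    hr.not_ge ((Finset.sum_nonneg fun i _ => hx.1 i).trans hx.2)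

theorem volume_orthantCorner_fin_succ (n : ℕ) (r : ℝ) :
    volume (orthantCorner (Fin (n + 1)) r) =
      ∫⁻ t in Set.Icc 0 r, volume (orthantCorner (Fin n) (r - t)) := by
  let e := MeasurableEquiv.piFinSuccAbove (fun _ : Fin (n + 1) => ℝ) 0
  have hmeas := (isClosed_orthantCorner (ι := Fin (n + 1)) r).measurableSet
  rw [← (volume_preserving_piFinSuccAbove (fun _ : Fin (n + 1) => ℝ) 0).symm.measure_preimage
    hmeas.nullMeasurableSet, Measure.volume_eq_prod, Measure.prod_apply (e.symm.measurable hmeas),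
    ← lintegral_indicator measurableSet_Icc]
  refine lintegral_congr fun t => ?_
  have hslice : Prod.mk t ⁻¹' (e.symm ⁻¹' orthantCorner (Fin (n + 1)) r) =
      {y | 0 ≤ t ∧ y ∈ orthantCorner (Fin n) (r - t)} := by
    ext y
    rw [Set.mem_ofPred_eq, ← cons_mem_orthantCorner, ← Fin.insertNth_zero']
    rfl
  rw [hslice, Set.indicator_apply]
  split_ifs with ht
  · simp only [ht.1, true_and, Set.ofPred_mem_eq]
  · rw [Set.mem_Icc, not_and_or, not_le, not_le] at ht
    rcases ht with ht | ht
    · simp only [ht.not_ge, false_and, Set.ofPred_false, measure_empty]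
    · rw [orthantCorner_eq_empty (sub_neg.2 ht)]
      simp only [measure_empty, Set.mem_empty_iff_false, and_false, Set.ofPred_false]

theorem volume_orthantCorner_fin (n : ℕ) : ∀ {r : ℝ}, 0 ≤ r →
    volume (orthantCorner (Fin n) r) = ENNReal.ofReal (r ^ n / n !) := by
  induction n with
  | zero =>
    intro r hr
    have huniv : orthantCorner (Fin 0) r = Set.univ :=
      Set.eq_univ_of_forall fun x => ⟨fun i => i.elim0, by simpa using hr⟩
    simp [huniv, volume_pi]
  | succ n ih =>
    intro r hr
    rw [volume_orthantCorner_fin_succ, setLIntegral_congr_fun measurableSet_Icc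
      fun t ht => ih (sub_nonneg.2 ht.2), ← ofReal_integral_eq_lintegral_ofReal]
    · rw [integral_Icc_eq_integral_Ioc, ← intervalIntegral.integral_of_le hr,
        intervalIntegral.integral_div, intervalIntegral.integral_comp_sub_left (fun x => x ^ n) r,
        integral_pow, Nat.factorial_succ, sub_self, sub_zero, zero_pow n.succ_ne_zero, sub_zero,
        div_div, Nat.cast_mul, Nat.cast_succ]
    · exact Continuous.integrableOn_Icc (by fun_prop)
    · filter_upwards [ae_restrict_mem measurableSet_Icc] with t ht
      have ht' := sub_nonneg.2 ht.2
      positivity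

theorem volume_orthantCorner {r : ℝ} (hr : 0 ≤ r) :
    volume (orthantCorner ι r) = ENNReal.ofReal (r ^ Fintype.card ι / (Fintype.card ι)!) := by
  let e := Fintype.equivFin ι
  have hpre : orthantCorner ι r = MeasurableEquiv.piCongrLeft (fun _ => ℝ) e ⁻¹'
      orthantCorner (Fin (Fintype.card ι)) r := by
    ext x
    have hx : ∀ j, (MeasurableEquiv.piCongrLeft (fun _ => ℝ) e) x j = x (e.symm j) := fun j => by
      obtain ⟨i, rfl⟩ := e.surjective j
      rw [MeasurableEquiv.coe_piCongrLeft, Equiv.piCongrLeft_apply_apply, Equiv.symm_apply_apply]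
    simp only [orthantCorner, Set.mem_preimage, Set.mem_ofPred_eq, Pi.le_def, hx,
      Equiv.sum_comp e.symm x, e.symm.forall_congr_left]
    simp
  rw [hpre, (volume_measurePreserving_piCongrLeft (fun _ => ℝ) e).measure_preimage
    (isClosed_orthantCorner r).nullMeasurableSet, volume_orthantCorner_fin _ hr]

theorem IsUnimodularSimplex.integralVolume_eq_one {Q : Type v} [Fintype Q] {S : Set (Q → ℝ)}
    (hS : IsUnimodularSimplex S) : integralVolume S = 1 := by
  classical
  obtain ⟨b, rfl⟩ := hS
  let B : Matrix Q Q ℤ := (Pi.basisFun ℤ Q).toMatrix b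
  have hB : IsUnit B.det := (Pi.basisFun ℤ Q).isUnit_det b
  let L : (Q → ℝ) →ₗ[ℝ] (Q → ℝ) := Matrix.toLin' (B.map (Int.castRingHom ℝ))
  have hdet : |LinearMap.det L| = 1 := by
    rw [LinearMap.det_toLin', ← RingHom.mapMatrix_apply, ← RingHom.map_det, eq_intCast,
      ← Int.cast_abs, Int.isUnit_iff_abs_eq.1 hB, Int.cast_one]
  have himage : convexHull ℝ ({0} ∪ Set.range fun x => fun i => ((b x i : ℤ) : ℝ)) =
      L '' orthantCorner Q 1 := by
    rw [← convexHull_zero_union_range_single, LinearMap.image_convexHull, Set.image_union,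
      Set.image_singleton, map_zero, ← Set.range_comp]
    congr 3
    funext x i
    simp [L, B, Module.Basis.toMatrix_apply]
  have hfact : ((Fintype.card Q)! : ℝ) ≠ 0 := by positivity
  rw [himage, integralVolume, Measure.addHaar_image_linearMap, hdet,
    volume_orthantCorner zero_le_one, ENNReal.ofReal_one, one_mul, one_pow,
    ← ENNReal.ofReal_natCast, ← ENNReal.ofReal_mul (Nat.cast_nonneg _), mul_one_div_cancel hfact,
    ENNReal.ofReal_one]

end SimplexVolume

section PrefixVectors

variable {Q : Type*} {pos : Q → ℕ}

/-- The indicator vector of the vertices at positions below `m`. -/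
def prefixVec (pos : Q → ℕ) (m : ℕ) : Q → ℤ := fun i => if pos i < m then 1 else 0

/-- The real vectors which are differences of two prefix vectors. For a linear quiver these are
the roots, that is, the vectors `±1_I` for intervals `I`. -/
def prefixDifferences (pos : Q → ℕ) : Set (Q → ℝ) :=
  {x | ∃ a b, x = fun i => ((prefixVec pos b - prefixVec pos a) i : ℝ)}

theorem neg_mem_prefixDifferences {x : Q → ℝ} (hx : x ∈ prefixDifferences pos) :
    -x ∈ prefixDifferences pos := by
  obtain ⟨a, b, rfl⟩ := hx
  exact ⟨b, a, funext fun i => by rw [Pi.neg_apply, ← Int.cast_neg, ← Pi.neg_apply, neg_sub]⟩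

theorem prefixVec_succ_pos [DecidableEq Q] (hpos : Function.Injective pos) (i : Q) :
    prefixVec pos (pos i + 1) = prefixVec pos (pos i) + Pi.single i 1 := by
  ext j
  simp only [prefixVec, Pi.add_apply, Pi.single_apply, ← hpos.eq_iff]
  grind

theorem prefixVec_succ_of_notMem_range {m : ℕ} (hm : m ∉ Set.range pos) :
    prefixVec pos (m + 1) = prefixVec pos m := by
  ext i
  have him : pos i ≠ m := fun h => hm ⟨i, h⟩
  simp only [prefixVec]
  grind

theorem sum_increment_mul_prefixVec [Fintype Q] (hpos : Function.Injective pos) {f : ℕ → ℝ}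
    (hf : ∀ m ∉ Set.range pos, f (m + 1) = f m) (m : ℕ) :
    ∑ i, (f (pos i + 1) - f (pos i)) * prefixVec pos m i = f m - f 0 := by
  classical
  induction m with
  | zero => simp [prefixVec]
  | succ m ih =>
    by_cases hm : m ∈ Set.range pos
    · obtain ⟨i, rfl⟩ := hm
      simp only [prefixVec_succ_pos hpos, Pi.add_apply, Int.cast_add, mul_add,
        Finset.sum_add_distrib, ih, Pi.single_apply, Int.cast_ite, Int.cast_one, Int.cast_zero,
        mul_ite, mul_one, mul_zero, Finset.sum_ite_eq', Finset.mem_univ, if_true]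
      ring
    · rw [prefixVec_succ_of_notMem_range hm, ih, hf m hm]

/- Call `a` and `b` equivalent if `prefixVec b - prefixVec a` lies in the `ℤ`-span `N` of the
family. The functional `∑ i, (f (pos i + 1) - f (pos i)) x i`, where `f` is the indicator of the
class of `pos i`, kills the family and hence vanishes, so `pos i` and `pos i + 1` are equivalent,
which means that `N` contains the `i`-th basis vector. -/
theorem single_mem_span_int_of_span_eq_top [Finite Q] [DecidableEq Q]
    (hpos : Function.Injective pos) {ι : Type*} {a b : ι → ℕ}
    (hspan : Submodule.span ℝ (Set.range fun j i =>
      ((prefixVec pos (b j) - prefixVec pos (a j)) i : ℝ)) = ⊤) (i : Q) :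
    Pi.single i 1 ∈
      Submodule.span ℤ (Set.range fun j => prefixVec pos (b j) - prefixVec pos (a j)) := by
  have := Fintype.ofFinite Q
  set N := Submodule.span ℤ (Set.range fun j => prefixVec pos (b j) - prefixVec pos (a j))
  let f : ℕ → ℝ := {m | prefixVec pos m - prefixVec pos (pos i) ∈ N}.indicator 1
  have hf : ∀ {m m'}, prefixVec pos m' - prefixVec pos m ∈ N → f m' = f m := fun {m m'} h => by
    have hiff := N.add_mem_iff_right (y := prefixVec pos m - prefixVec pos (pos i)) h
    rw [sub_add_sub_cancel] at hiff
    classical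
    exact if_congr hiff rfl rfl
  let η : (Q → ℝ) →ₗ[ℝ] ℝ := ∑ i, (f (pos i + 1) - f (pos i)) • LinearMap.proj i
  have hη : ∀ x, η x = ∑ i, (f (pos i + 1) - f (pos i)) * x i := fun x => by
    simp only [η, LinearMap.sum_apply, LinearMap.smul_apply, LinearMap.proj_apply, smul_eq_mul]
  have hη_zero : η = 0 := by
    refine LinearMap.ext_on_range hspan fun j => ?_
    have hsum := sum_increment_mul_prefixVec hpos (f := f) fun m hm => hf (by
      rw [prefixVec_succ_of_notMem_range hm, sub_self]
      exact N.zero_mem)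
    simp only [hη, Pi.sub_apply, Int.cast_sub, mul_sub, Finset.sum_sub_distrib, hsum,
      LinearMap.zero_apply]
    rw [hf (Submodule.subset_span ⟨j, rfl⟩), sub_self]
  have hstep : f (pos i + 1) = 1 := by
    have h := hη (Pi.single i 1)
    simp only [hη_zero, LinearMap.zero_apply, Pi.single_apply, mul_ite, mul_one, mul_zero,
      Finset.sum_ite_eq', Finset.mem_univ, if_true] at h
    exact (sub_eq_zero.1 h.symm).trans (Set.indicator_of_mem (by simp) 1)
  have hmem : pos i + 1 ∈ {m | prefixVec pos m - prefixVec pos (pos i) ∈ N} :=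
    Set.mem_of_indicator_ne_zero (hstep.trans_ne one_ne_zero)
  rwa [Set.mem_ofPred_eq, prefixVec_succ_pos hpos, add_sub_cancel_left] at hmem

theorem isUnimodularSimplex_of_linearIndepOn [Fintype Q] (hpos : Function.Injective pos)
    {κ : Type*} {vec : κ → Q → ℝ} {S : Set κ} (hS : ∀ q ∈ S, vec q ∈ prefixDifferences pos)
    (hli : LinearIndepOn ℝ vec S) (hcard : S.ncard = Fintype.card Q) :
    IsUnimodularSimplex (convexHull ℝ ({0} ∪ vec '' S)) := by
  classical
  have : Finite S := hli.finite
  have := Fintype.ofFinite S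
  let e : Q ≃ S := Fintype.equivOfCardEq
    (by rw [← hcard, ← Nat.card_coe_set_eq, Nat.card_eq_fintype_card])
  choose a b hab using fun j : Q => hS _ (e j).2
  have hrange : Set.range (fun j i => ((prefixVec pos (b j) - prefixVec pos (a j)) i : ℝ)) =
      vec '' S := by
    rw [← funext hab, Set.image_eq_range]
    exact e.surjective.range_comp fun q : S => vec q
  have hspan : Submodule.span ℝ (vec '' S) = ⊤ := by
    rw [← hrange, ← funext hab]
    exact LinearIndependent.span_eq_top_of_card_eq_finrank'
      (LinearIndependent.comp hli e e.injective) (Module.finrank_fintype_fun_eq_card ℝ).symm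
  have hspan_int : ⊤ ≤ Submodule.span ℤ
      (Set.range fun j => prefixVec pos (b j) - prefixVec pos (a j)) := by
    rw [← (Pi.basisFun ℤ Q).span_eq, Submodule.span_le]
    rintro _ ⟨i, rfl⟩
    rw [Pi.basisFun_apply]
    exact single_mem_span_int_of_span_eq_top hpos (hrange ▸ hspan) i
  refine ⟨basisOfTopLeSpanOfCardEqFinrank _ hspan_int
    (Module.finrank_fintype_fun_eq_card ℤ).symm, ?_⟩
  rw [coe_basisOfTopLeSpanOfCardEqFinrank, ← hrange]

end PrefixVectors

section Tiling

variable {Q : Type v} {pos : Q → ℕ} {κ κ' 𝒯 C : Type*} {P : 𝒯 → Prop} {cls : 𝒯 → C}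
  {σ : 𝒯 → Set (Q → ℝ)}

/-- The sets `σ T` for the objects `T` satisfying `P` depend only on the class `cls T`, are finitely
many unimodular simplices, and overlap in null sets if the classes differ. -/
structure IsUnimodularTiling [Fintype Q] (P : 𝒯 → Prop) (cls : 𝒯 → C) (σ : 𝒯 → Set (Q → ℝ)) :
    Prop where
  isUnimodularSimplex : ∀ {T}, P T → IsUnimodularSimplex (σ T)
  volume_inter : ∀ {T T'}, P T → P T' → cls T ≠ cls T' → volume (σ T ∩ σ T') = 0
  eq_of_cls_eq : ∀ {T T'}, P T → P T' → cls T = cls T' → σ T = σ T'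
  finite_image : (σ '' {T | P T}).Finite

theorem IsUnimodularSimplex.measurableSet [Finite Q] {S : Set (Q → ℝ)}
    (hS : IsUnimodularSimplex S) : MeasurableSet S := by
  have := Fintype.ofFinite Q
  obtain ⟨b, rfl⟩ := hS
  exact (((Set.finite_singleton 0).union (Set.finite_range _)).isCompact_convexHull
    ℝ).measurableSet

namespace IsUnimodularTiling

variable [Fintype Q] (h : IsUnimodularTiling P cls σ)

include h

theorem cls_eq_of_eq {T T' : 𝒯} (hT : P T) (hT' : P T') (heq : σ T = σ T') : cls T = cls T' := by
  by_contra hne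
  have hzero : volume (σ T) = 0 := by
    rw [← h.volume_inter hT hT' hne, ← heq, Set.inter_self]
  have hone := (h.isUnimodularSimplex hT).integralVolume_eq_one
  rw [integralVolume, hzero, mul_zero] at hone
  exact zero_ne_one hone

theorem exists_representatives :
    ∃ R ⊆ {T | P T}, R.Finite ∧ Set.BijOn cls R {c | ∃ T, P T ∧ cls T = c} := by
  obtain ⟨R, hR, hbij⟩ := (Set.surjOn_image cls {T | P T}).exists_bijOn_subset
  refine ⟨R, hR, Set.Finite.of_finite_image (h.finite_image.subset (Set.image_mono hR)) ?_, hbij⟩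
  exact fun T hT T' hT' heq => hbij.injOn hT hT' (h.cls_eq_of_eq (hR hT) (hR hT') heq)

theorem finite_classes : {c | ∃ T, P T ∧ cls T = c}.Finite := by
  obtain ⟨R, -, hfin, hbij⟩ := h.exists_representatives
  exact hbij.finite_iff_finite.1 hfin

theorem integralVolume_eq_ncard :
    integralVolume {x | ∃ T, P T ∧ x ∈ σ T} = ({c | ∃ T, P T ∧ cls T = c}.ncard : ℝ≥0∞) := by
  obtain ⟨R, hR, hfin, hbij⟩ := h.exists_representatives
  have hP : ∀ {T}, T ∈ hfin.toFinset → P T := fun hT => hR (hfin.mem_toFinset.1 hT)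
  have hunion : {x | ∃ T, P T ∧ x ∈ σ T} = ⋃ T ∈ hfin.toFinset, σ T := by
    ext x
    simp only [Set.mem_iUnion, exists_prop, hfin.mem_toFinset]
    refine ⟨fun ⟨T, hT, hx⟩ => ?_, fun ⟨T, hT, hx⟩ => ⟨T, hR hT, hx⟩⟩
    obtain ⟨T', hT', heq⟩ := hbij.surjOn ⟨T, hT, rfl⟩
    exact ⟨T', hT', h.eq_of_cls_eq (hR hT') hT heq ▸ hx⟩
  have hdisj : (hfin.toFinset : Set 𝒯).Pairwise (Function.onFun (AEDisjoint volume) σ) :=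
    fun T hT T' hT' hne => h.volume_inter (hP hT) (hP hT') fun heq =>
      hne (hbij.injOn (hfin.mem_toFinset.1 hT) (hfin.mem_toFinset.1 hT') heq)
  rw [hunion, integralVolume, measure_biUnion_finset₀ hdisj fun T hT =>
      (h.isUnimodularSimplex (hP hT)).measurableSet.nullMeasurableSet, Finset.mul_sum,
    ← hbij.image_eq, hbij.injOn.ncard_image, Set.ncard_eq_toFinset_card _ hfin,
    Finset.cast_card]
  exact Finset.sum_congr rfl fun T hT => (h.isUnimodularSimplex (hP hT)).integralVolume_eq_one

end IsUnimodularTiling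

theorem finite_prefixDifferences [Finite Q] (pos : Q → ℕ) : (prefixDifferences pos).Finite := by
  refine (Set.Finite.pi' fun _ => Set.toFinite ({-1, 0, 1} : Set ℝ)).subset ?_
  rintro _ ⟨a, b, rfl⟩ i
  simp only [prefixVec, Pi.sub_apply, Set.mem_insert_iff, Set.mem_singleton_iff]
  split_ifs <;> simp

theorem IsUnimodularTiling.of_isSimplicialFan [Fintype Q] (hpos : Function.Injective pos)
    {vec : κ → Q → ℝ} {𝒟 : Set (Set κ)} (hfan : IsSimplicialFan vec 𝒟) (code : 𝒯 → Set κ)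
    (hcode : ∀ {T}, P T → code T ∈ 𝒟)
    (hvec : ∀ {T}, P T → ∀ q ∈ code T, vec q ∈ prefixDifferences pos)
    (hcard : ∀ {T}, P T → (code T).ncard = Fintype.card Q)
    (hσ : ∀ {T}, P T → σ T = convexHull ℝ ({0} ∪ vec '' code T))
    (hcls : ∀ {T T'}, P T → P T' → (code T = code T' ↔ cls T = cls T')) :
    IsUnimodularTiling P cls σ where
  isUnimodularSimplex hT := by
    rw [hσ hT]
    exact isUnimodularSimplex_of_linearIndepOn hpos (hvec hT) (hfan.linearIndepOn (hcode hT))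
      (hcard hT)
  volume_inter hT hT' hne := by
    rw [hσ hT, hσ hT']
    exact hfan.volume_inter_convexHull (hcode hT) (hcode hT') (mt (hcls hT hT').1 hne)
  eq_of_cls_eq hT hT' heq := by rw [hσ hT, hσ hT', (hcls hT hT').2 heq]
  finite_image := by
    refine ((finite_prefixDifferences pos).finite_subsets.image
      fun A => convexHull ℝ ({0} ∪ A)).subset ?_
    rintro _ ⟨T, hT, rfl⟩
    exact ⟨vec '' code T, Set.image_subset_iff.2 (hvec hT), (hσ hT).symm⟩

theorem sumEquiv_symm_mem_signedJoin {vec : κ → Q → ℝ} {vec' : κ' → Q → ℝ} {𝒟 : Set (Set κ)}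
    {ℰ : Set (Set κ')} {A : Set κ} {B : Set κ'} (hA : A ∈ 𝒟) (hB : B ∈ ℰ)
    (hdisj : ∀ a ∈ A, ∀ b ∈ B, Disjoint (Function.support (vec a)) (Function.support (vec' b))) :
    Set.sumEquiv.symm (A, B) ∈ signedJoin vec vec' 𝒟 ℰ := by
  have hinl : Sum.inl ⁻¹' Set.sumEquiv.symm (A, B) = A :=
    congrArg Prod.fst (Set.sumEquiv.apply_symm_apply (A, B))
  have hinr : Sum.inr ⁻¹' Set.sumEquiv.symm (A, B) = B :=
    congrArg Prod.snd (Set.sumEquiv.apply_symm_apply (A, B))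
  exact ⟨hinl.symm ▸ hA, hinr.symm ▸ hB, fun a b ha hb =>
    hdisj a (hinl ▸ Set.mem_preimage.2 ha) b (hinr ▸ Set.mem_preimage.2 hb)⟩

theorem image_sumElim_sumEquiv_symm {E : Type*} (f : κ → E) (g : κ' → E) (A : Set κ)
    (B : Set κ') : Sum.elim f g '' Set.sumEquiv.symm (A, B) = f '' A ∪ g '' B := by
  change Sum.elim f g '' (Sum.inl '' A ∪ Sum.inr '' B) = f '' A ∪ g '' B
  rw [Set.image_union, Set.image_image, Set.image_image]
  rfl

theorem ncard_sumEquiv_symm {A : Set κ} {B : Set κ'} (hA : A.Finite) (hB : B.Finite) :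
    (Set.sumEquiv.symm (A, B)).ncard = A.ncard + B.ncard := by
  change (Sum.inl '' A ∪ Sum.inr '' B).ncard = A.ncard + B.ncard
  rw [Set.ncard_union_eq Set.disjoint_image_inl_image_inr (hA.image _) (hB.image _),
    Set.ncard_image_of_injective _ Sum.inl_injective,
    Set.ncard_image_of_injective _ Sum.inr_injective]

theorem IsUnimodularTiling.of_signedJoin [Fintype Q] (hpos : Function.Injective pos)
    {vec : κ → Q → ℝ} {vec' : κ' → Q → ℝ} {𝒟 : Set (Set κ)} {ℰ : Set (Set κ')}
    (hfan : IsSimplicialFan vec 𝒟) (hfan' : IsSimplicialFan vec' ℰ) (hnonneg : 0 ≤ vec)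
    (hnonneg' : 0 ≤ vec') (A : 𝒯 → Set κ) (B : 𝒯 → Set κ') (hA : ∀ {T}, P T → A T ∈ 𝒟)
    (hB : ∀ {T}, P T → B T ∈ ℰ)
    (hdisj : ∀ {T}, P T → ∀ a ∈ A T, ∀ b ∈ B T,
      Disjoint (Function.support (vec a)) (Function.support (vec' b)))
    (hvec : ∀ {T}, P T → ∀ a ∈ A T, vec a ∈ prefixDifferences pos)
    (hvec' : ∀ {T}, P T → ∀ b ∈ B T, vec' b ∈ prefixDifferences pos)
    (hcard : ∀ {T}, P T → (A T).ncard + (B T).ncard = Fintype.card Q)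
    (hσ : ∀ {T}, P T → σ T = convexHull ℝ ({0} ∪ vec '' A T ∪ (-vec') '' B T))
    (hcls : ∀ {T T'}, P T → P T' → (A T = A T' ∧ B T = B T' ↔ cls T = cls T')) :
    IsUnimodularTiling P cls σ := by
  refine .of_isSimplicialFan hpos (hfan.signedJoin hfan' hnonneg hnonneg')
    (fun T => Set.sumEquiv.symm (A T, B T))
    (fun hT => sumEquiv_symm_mem_signedJoin (hA hT) (hB hT) (hdisj hT)) (fun {T} hT q hq => ?_)
    (fun {T} hT => ?_) (fun {T} hT => ?_) (fun {T T'} hT hT' => ?_)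
  · rcases hq with ⟨a, ha, rfl⟩ | ⟨b, hb, rfl⟩
    · exact hvec hT a ha
    · exact neg_mem_prefixDifferences (hvec' hT b hb)
  · rw [ncard_sumEquiv_symm (hfan.linearIndepOn (hA hT)).finite
      (hfan'.linearIndepOn (hB hT)).finite, hcard hT]
  · rw [hσ hT, image_sumElim_sumEquiv_symm, Set.union_assoc]
  · rw [EmbeddingLike.apply_eq_iff_eq, Prod.mk_inj, hcls hT hT']

end Tiling

namespace QuiverRep

section Restrict

variable {k : Type u} [Field k] {Q : Type v} [Quiver.{w} Q] {V W : QuiverRep k Q} {S : Set Q}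

theorem subsingleton_of_notMem (hV : V.support ⊆ S) {i : Q} (hi : i ∉ S) :
    Subsingleton (V.space i) :=
  Module.finrank_zero_iff.1 (not_not.1 fun h => hi (hV h))

open Classical in
theorem IsIsomorphic.of_restrict (hV : V.support ⊆ S) (hW : W.support ⊆ S)
    (h : IsIsomorphic (V.restrict S) (W.restrict S)) : IsIsomorphic V W := by
  obtain ⟨e⟩ := h
  let E (i : Q) (hi : i ∈ S) : V.space i ≃ₗ[k] W.space i := e.equiv ⟨i, hi⟩
  have hV' : ∀ {i}, i ∉ S → Subsingleton (V.space i) := fun hi => subsingleton_of_notMem hV hi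
  have hW' : ∀ {i}, i ∉ S → Subsingleton (W.space i) := fun hi => subsingleton_of_notMem hW hi
  refine ⟨⟨fun i => if hi : i ∈ S then E i hi else
    have := hV' hi
    have := hW' hi
    0, fun {i j} α x => ?_⟩⟩
  by_cases hi : i ∈ S
  · by_cases hj : j ∈ S
    · rw [dif_pos hi, dif_pos hj]
      exact e.comm (i := ⟨i, hi⟩) (j := ⟨j, hj⟩) α x
    · exact (hW' hj).elim _ _
  · rw [(hV' hi).elim x 0, map_zero, map_zero, map_zero, map_zero]

open Classical in
theorem IsRigid.of_restrict (hV : V.support ⊆ S) (h : (V.restrict S).IsRigid) : V.IsRigid := by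
  rw [isRigid_iff_surjective_extMap] at h ⊢
  intro g
  obtain ⟨f, hf⟩ := h fun i j α => g i j α
  let f' (i : Q) (hi : i ∈ S) : V.space i →ₗ[k] V.space i := f ⟨i, hi⟩
  refine ⟨fun i => if hi : i ∈ S then f' i hi else 0, ?_⟩
  funext i j α
  ext x
  by_cases hi : i ∈ S
  · by_cases hj : j ∈ S
    · rw [extMap_apply, dif_pos hi, dif_pos hj]
      exact LinearMap.congr_fun (congrFun₃ hf ⟨i, hi⟩ ⟨j, hj⟩ α) x
    · exact (subsingleton_of_notMem hV hj).elim _ _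
  · rw [(subsingleton_of_notMem hV hi).elim x 0, map_zero, map_zero]

theorem IsLinear.subtype {pos : Q → ℕ} {dir : ℕ → Bool} (hQ : IsLinear Q pos dir) (S : Set Q) :
    IsLinear S (fun i => pos i) dir where
  pos_injective := hQ.pos_injective.comp Subtype.val_injective
  subsingleton_hom i j := hQ.subsingleton_hom i j
  dir_of_hom {i j} α := hQ.dir_of_hom (i := i) (j := j) α
  hom_right {i j} h hd := hQ.hom_right (i := i) (j := j) h hd
  hom_left {i j} h hd := hQ.hom_left (i := i) (j := j) h hd

end Restrict

end QuiverRep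

namespace TypeA

variable {n : ℕ} {o : Fin (n - 1) → Bool}

/-- The direction of the edge between the positions `e` and `e + 1`, with a junk value for the
positions that carry no edge. -/
def dir (o : Fin (n - 1) → Bool) (e : ℕ) : Bool := if h : e < n - 1 then o ⟨e, h⟩ else true

theorem dir_val (e : Fin (n - 1)) : dir o e = o e := dif_pos e.2

theorem pos_lt (i : TypeA n o) : i.pos < n := Fin.is_lt (n := n) i

theorem pos_lt_pred {i j : TypeA n o} (h : j.pos = i.pos + 1) : i.pos < n - 1 :=
  Nat.lt_sub_of_add_lt (h ▸ j.pos_lt)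

theorem isLinear : QuiverRep.IsLinear (TypeA n o) TypeA.pos (dir o) where
  pos_injective := Fin.val_injective (n := n)
  subsingleton_hom i j := ⟨fun ⟨e, he⟩ ⟨f, hf⟩ => Subtype.ext (Fin.ext (by dsimp only; omega))⟩
  dir_of_hom := by
    rintro i j ⟨e, ⟨hdir, hi, hj⟩ | ⟨hdir, hi, hj⟩⟩
    · exact Or.inl ⟨by rw [hi, dir_val, hdir], by rw [hj, hi]⟩
    · exact Or.inr ⟨by rw [hj, dir_val, hdir], by rw [hi, hj]⟩
  hom_right {i j} h hdir :=
    ⟨⟨⟨i.pos, pos_lt_pred h⟩, Or.inl ⟨(dir_val ⟨i.pos, pos_lt_pred h⟩).symm.trans hdir, rfl, h⟩⟩⟩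
  hom_left {i j} h hdir :=
    ⟨⟨⟨i.pos, pos_lt_pred h⟩, Or.inr ⟨(dir_val ⟨i.pos, pos_lt_pred h⟩).symm.trans hdir, h, rfl⟩⟩⟩

end TypeA

theorem ncard_le_of_linearIndepOn_of_support_subset {κ ι : Type*} [Finite ι] {vec : κ → ι → ℝ}
    {S : Set κ} {A : Set ι} (h : LinearIndepOn ℝ vec S)
    (hA : ∀ q ∈ S, Function.support (vec q) ⊆ A) : S.ncard ≤ A.ncard := by
  classical
  have := Fintype.ofFinite ι
  have : Finite S := h.finite
  have := Fintype.ofFinite S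
  have hspan : Set.range (fun q : S => vec q) ≤
      Submodule.span ℝ ((fun i => (Pi.single i 1 : ι → ℝ)) '' A) := by
    rintro _ ⟨q, rfl⟩
    beta_reduce
    rw [SetLike.mem_coe, pi_eq_sum_univ' (vec q)]
    refine Submodule.sum_mem _ fun i _ => ?_
    by_cases hi : i ∈ A
    · exact Submodule.smul_mem _ _ (Submodule.subset_span ⟨i, hi, rfl⟩)
    · rw [Function.notMem_support.1 fun h => hi (hA q q.2 h), zero_smul]
      exact Submodule.zero_mem _
  calc S.ncard = Fintype.card S := by rw [← Nat.card_coe_set_eq, Nat.card_eq_fintype_card]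
    _ ≤ Fintype.card ((fun i => (Pi.single i 1 : ι → ℝ)) '' A) :=
      linearIndependent_le_span_aux' _ h _ hspan
    _ = ((fun i => (Pi.single i 1 : ι → ℝ)) '' A).ncard := by
      rw [← Nat.card_coe_set_eq, Nat.card_eq_fintype_card]
    _ ≤ A.ncard := Set.ncard_image_le A.toFinite

namespace QuiverRep

section SummandIntervals

variable {k : Type u} [Field k] {Q : Type v} [Quiver.{w} Q] {pos : Q → ℕ} {dir : ℕ → Bool}
  {T T' : QuiverRep k Q} {F : Finset (ℕ × ℕ)}

/-- The intervals of the indecomposable direct summands of `T`, for a linear quiver. -/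
def summandIntervals (pos : Q → ℕ) (T : QuiverRep k Q) : Set (ℕ × ℕ) :=
  {q | IsOccupied pos q ∧ (thin k (interval pos q)).IsSummand T}

theorem IsIsomorphic.summandIntervals_eq (h : IsIsomorphic T T') :
    summandIntervals pos T = summandIntervals pos T' :=
  Set.ext fun _ => and_congr_right fun _ => ⟨.congr_right h, .congr_right h.symm⟩

theorem IsLinear.summandDims_eq [Finite Q] (hQ : IsLinear Q pos dir) (T : QuiverRep k Q) :
    T.summandDims = intervalVec pos '' summandIntervals pos T := by
  ext d
  constructor
  · rintro ⟨M, hM, hMT, rfl⟩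
    obtain ⟨q, hq, hMq⟩ := hQ.exists_isIsomorphic_thin hM
    exact ⟨q, ⟨hq, hMT.congr_left hMq⟩, (hMq.dimVec_eq.trans (dimVec_thin _)).symm⟩
  · rintro ⟨q, ⟨hq, hqT⟩, rfl⟩
    exact ⟨_, hQ.isIndecomposable_thin hq, hqT, (dimVec_thin _).symm⟩

theorem support_intervalVec_subset {q : ℕ × ℕ} (hq : q ∈ summandIntervals pos T) :
    Function.support (intervalVec pos q) ⊆ T.support := by
  rw [support_intervalVec, ← support_thin (k := k) (interval pos q)]
  exact hq.2.support_subset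

theorem IsRigid.summandIntervals_mem_compatibleSets (hT : T.IsRigid) (hQ : IsLinear Q pos dir) :
    summandIntervals pos T ∈ compatibleSets pos dir :=
  ⟨fun _ hp => hp.1, fun _ hp _ hq => hT.compatible hQ hp.1 hq.1 hp.2 hq.2⟩

theorem IsRigid.finite_summandIntervals [Finite Q] (hT : T.IsRigid) (hQ : IsLinear Q pos dir) :
    (summandIntervals pos T).Finite :=
  ((isSimplicialFan_compatibleSets pos dir).linearIndepOn
    (hT.summandIntervals_mem_compatibleSets hQ)).finite

theorem IsRigid.ncard_summandIntervals_le [Finite Q] (hT : T.IsRigid) (hQ : IsLinear Q pos dir) :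
    (summandIntervals pos T).ncard ≤ T.support.ncard :=
  ncard_le_of_linearIndepOn_of_support_subset
    ((isSimplicialFan_compatibleSets pos dir).linearIndepOn
      (hT.summandIntervals_mem_compatibleSets hQ)) fun _ => support_intervalVec_subset

/-- The direct sum of the interval representations of the members of `F`. -/
noncomputable def intervalSum (k : Type u) [Field k] {Q : Type v} [Quiver.{w} Q] (pos : Q → ℕ)
    (F : Finset (ℕ × ℕ)) : QuiverRep k Q :=
  directSum fun q : F => thin k (interval pos q)

theorem IsRigid.coe_eq_summandIntervals [Finite Q] (hT : T.IsRigid) (hQ : IsLinear Q pos dir)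
    (hF : ∀ q ∈ F, IsOccupied pos q) (hiso : IsIsomorphic T (intervalSum k pos F))
    (hcard : T.support.ncard ≤ F.card) : (F : Set (ℕ × ℕ)) = summandIntervals pos T := by
  refine Set.eq_of_subset_of_ncard_le (fun q hq => ⟨hF q hq, ?_⟩) ?_
    (hT.finite_summandIntervals hQ)
  · exact (isSummand_directSum (fun q : F => thin k (interval pos q)) ⟨q, hq⟩).congr_right hiso.symm
  · rw [Set.ncard_coe_finset]
    exact (hT.ncard_summandIntervals_le hQ).trans hcard

theorem IsLinear.exists_isIsomorphic_intervalSum [Finite Q] (hQ : IsLinear Q pos dir) {m : ℕ}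
    {M : Fin m → QuiverRep k Q} (hM : ∀ x, (M x).IsIndecomposable)
    (hne : ∀ x y, x ≠ y → ¬ IsIsomorphic (M x) (M y)) :
    ∃ F : Finset (ℕ × ℕ), F.card = m ∧ (∀ q ∈ F, IsOccupied pos q) ∧
      IsIsomorphic (directSum M) (intervalSum k pos F) := by
  choose p hp hiso using fun x => hQ.exists_isIsomorphic_thin (hM x)
  have hinj : Function.Injective p := fun x y hxy => by
    by_contra h
    exact hne x y h ((hiso x).trans (hxy ▸ (hiso y).symm))
  let e : Fin m ≃ Finset.univ.map ⟨p, hinj⟩ :=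
    (Equiv.ofInjective p hinj).trans (Equiv.subtypeEquivRight fun q => by simp)
  refine ⟨Finset.univ.map ⟨p, hinj⟩, ?_, ?_, (IsIsomorphic.directSum_congr hiso).trans
    (IsIsomorphic.directSum_reindex e
      fun q : Finset.univ.map ⟨p, hinj⟩ => thin k (interval pos q)).symm⟩
  · rw [Finset.card_map, Finset.card_univ, Fintype.card_fin]
  · rintro q hq
    obtain ⟨x, -, rfl⟩ := Finset.mem_map.1 hq
    exact hp x

/-- A rigid representation of a linear quiver that is the direct sum of pairwise non-isomorphic
interval representations, as many as its support has vertices. -/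
structure IsIntervalTilting (pos : Q → ℕ) (T : QuiverRep k Q) : Prop where
  isRigid : T.IsRigid
  exists_isIsomorphic : ∃ F : Finset (ℕ × ℕ), (F : Set (ℕ × ℕ)) = summandIntervals pos T ∧
    IsIsomorphic T (intervalSum k pos F)
  ncard_eq : (summandIntervals pos T).ncard = T.support.ncard

theorem IsIntervalTilting.summandIntervals_eq_iff (h : IsIntervalTilting pos T)
    (h' : IsIntervalTilting pos T') :
    summandIntervals pos T = summandIntervals pos T' ↔ T.isoClass = T'.isoClass := by
  rw [isoClass_eq_iff]
  refine ⟨fun heq => ?_, IsIsomorphic.summandIntervals_eq⟩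
  obtain ⟨F, hF, hiso⟩ := h.exists_isIsomorphic
  obtain ⟨F', hF', hiso'⟩ := h'.exists_isIsomorphic
  obtain rfl : F = F' := Finset.coe_injective (hF.trans (heq.trans hF'.symm))
  exact hiso.trans hiso'.symm

theorem IsRigid.isIntervalTilting [Finite Q] (hT : T.IsRigid) (hQ : IsLinear Q pos dir)
    (hF : ∀ q ∈ F, IsOccupied pos q) (hiso : IsIsomorphic T (intervalSum k pos F))
    (hcard : T.support.ncard ≤ F.card) : IsIntervalTilting pos T := by
  have hF' := hT.coe_eq_summandIntervals hQ hF hiso hcard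
  refine ⟨hT, ⟨F, hF', hiso⟩, (hT.ncard_summandIntervals_le hQ).antisymm ?_⟩
  rwa [← hF', Set.ncard_coe_finset]

theorem support_intervalSum_subset (F : Finset (ℕ × ℕ)) :
    (intervalSum k pos F).support ⊆ ⋃ q ∈ F, interval pos q := fun i hi => by
  contrapose! hi
  rw [Set.mem_iUnion₂, not_exists] at hi
  refine not_not.2 ((Module.finrank_pi_fintype k).trans ?_)
  exact Finset.sum_eq_zero fun q _ => finrank_thin_of_notMem fun h => hi q ⟨q.2, h⟩

theorem IsTilting.isIntervalTilting_and_support_eq_univ [Finite Q] (hT : T.IsTilting)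
    (hQ : IsLinear Q pos dir) : IsIntervalTilting pos T ∧ T.support = Set.univ := by
  obtain ⟨hrigid, M, hM, hne, hiso⟩ := hT
  obtain ⟨F, hcard, hF, hisoF⟩ := hQ.exists_isIsomorphic_intervalSum hM hne
  have h := hrigid.isIntervalTilting hQ hF (hiso.trans hisoF)
    (hcard ▸ (Set.ncard_le_card _))
  refine ⟨h, (Set.eq_univ_iff_ncard _).2 ((Set.ncard_le_card _).antisymm ?_)⟩
  rw [← h.ncard_eq, ← hrigid.coe_eq_summandIntervals hQ hF (hiso.trans hisoF)
    (hcard ▸ Set.ncard_le_card _), Set.ncard_coe_finset, hcard]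

theorem IsSupportTilting.isIntervalTilting [Finite Q] (hT : T.IsSupportTilting)
    (hQ : IsLinear Q pos dir) : IsIntervalTilting pos T := by
  obtain ⟨hrigid, M, hM, hne, hiso⟩ := hT
  obtain ⟨F, hcard, hF, hisoF⟩ := (hQ.subtype T.support).exists_isIsomorphic_intervalSum hM hne
  refine (hrigid.of_restrict subset_rfl).isIntervalTilting hQ (F := F) (fun q hq => ?_) ?_
    (hcard ▸ (Nat.card_coe_set_eq _).ge)
  · exact ⟨(hF q hq).1, fun e he => ((hF q hq).2 e he).imp' _ fun _ h => h⟩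
  · refine IsIsomorphic.of_restrict subset_rfl ?_ (hiso.trans hisoF)
    refine (support_intervalSum_subset F).trans (Set.iUnion₂_subset fun q hq i hi => ?_)
    obtain ⟨j, hj⟩ := (hF q hq).2 (pos i) hi
    exact hQ.pos_injective hj ▸ j.2

end SummandIntervals

end QuiverRep

section Roots

variable {Q : Type*} {pos : Q → ℕ}

theorem single_mem_prefixDifferences [DecidableEq Q] (hpos : Function.Injective pos) (j : Q) :
    Pi.single j 1 ∈ prefixDifferences pos := by
  refine ⟨pos j, pos j + 1, ?_⟩
  rw [prefixVec_succ_pos hpos, add_sub_cancel_left]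
  ext i
  rw [Pi.single_apply, Pi.single_apply, Int.cast_ite, Int.cast_one, Int.cast_zero]

namespace QuiverRep

theorem IsOccupied.intervalVec_mem_prefixDifferences {p : ℕ × ℕ} (hp : IsOccupied pos p) :
    intervalVec pos p ∈ prefixDifferences pos := by
  classical
  refine ⟨p.1, p.2 + 1, funext fun i => ?_⟩
  have := hp.1
  simp only [intervalVec, interval, Set.indicator_apply, Set.mem_preimage, Set.mem_Icc,
    Pi.one_apply, prefixVec, Pi.sub_apply, Int.cast_sub, Int.cast_ite, Int.cast_one,
    Int.cast_zero]
  grind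

end QuiverRep

end Roots

namespace QuiverRep

section TiltingTilings

variable {k : Type u} [Field k] {Q : Type v} [Quiver.{w} Q] {pos : Q → ℕ}
  {dir : ℕ → Bool}

theorem simplexSupp_eq [Finite Q] [DecidableEq Q] (hQ : IsLinear Q pos dir) (T : QuiverRep k Q) :
    T.simplexSupp = convexHull ℝ ({0} ∪ intervalVec pos '' summandIntervals pos T ∪
      (-fun j => Pi.single j 1) '' T.supportᶜ) := by
  rw [simplexSupp, hQ.summandDims_eq]
  congr 2
  ext d
  exact exists_congr fun j => and_congr_right fun _ => eq_comm

theorem simplexTwo_eq [Finite Q] (hQ : IsLinear Q pos dir) (T : QuiverRep k Q × QuiverRep k Q) :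
    simplexTwo T = convexHull ℝ ({0} ∪ intervalVec pos '' summandIntervals pos T.1 ∪
      (-intervalVec pos) '' summandIntervals pos T.2) := by
  rw [simplexTwo, hQ.summandDims_eq, hQ.summandDims_eq]
  congr 2
  ext d
  exact exists_congr fun q => and_congr_right fun _ => neg_eq_iff_eq_neg.symm

variable [Fintype Q] (hQ : IsLinear Q pos dir)

include hQ

theorem IsLinear.isUnimodularTiling_tilting :
    IsUnimodularTiling (IsTilting (k := k) (Q := Q)) isoClass simplexTilt := by
  have htilt : ∀ {T : QuiverRep k Q}, T.IsTilting → IsIntervalTilting pos T := fun hT =>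
    (hT.isIntervalTilting_and_support_eq_univ hQ).1
  refine .of_isSimplicialFan hQ.pos_injective (isSimplicialFan_compatibleSets pos dir)
    (summandIntervals pos)
    (fun hT => hT.1.summandIntervals_mem_compatibleSets hQ)
    (fun _ _ hq => hq.1.intervalVec_mem_prefixDifferences) (fun hT => ?_)
    (fun {T} _ => by rw [simplexTilt, hQ.summandDims_eq])
    (fun hT hT' => (htilt hT).summandIntervals_eq_iff (htilt hT'))
  rw [(htilt hT).ncard_eq, (hT.isIntervalTilting_and_support_eq_univ hQ).2, Set.ncard_univ,
    Nat.card_eq_fintype_card]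

theorem IsLinear.isUnimodularTiling_supportTilting [DecidableEq Q] :
    IsUnimodularTiling (IsSupportTilting (k := k) (Q := Q)) isoClass simplexSupp := by
  refine .of_signedJoin hQ.pos_injective (isSimplicialFan_compatibleSets pos dir)
    (isSimplicialFan_single Set.univ) intervalVec_nonneg
    (fun j => (Pi.single_nonneg.2 zero_le_one : (0 : Q → ℝ) ≤ Pi.single j 1))
    (summandIntervals pos) (fun T => T.supportᶜ)
    (fun hT => (hT.isIntervalTilting hQ).isRigid.summandIntervals_mem_compatibleSets hQ)
    (fun _ => Set.mem_univ _) (fun _ q hq j hj => ?_)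
    (fun _ _ hq => hq.1.intervalVec_mem_prefixDifferences)
    (fun _ j _ => single_mem_prefixDifferences hQ.pos_injective j) (fun hT => ?_)
    (fun _ => simplexSupp_eq hQ _) (fun hT hT' => ?_)
  · refine Set.disjoint_of_subset (support_intervalVec_subset hq) Pi.support_single_subset ?_
    exact Set.disjoint_singleton_right.2 hj
  · rw [(hT.isIntervalTilting hQ).ncard_eq, Set.ncard_add_ncard_compl, Nat.card_eq_fintype_card]
  · rw [(hT.isIntervalTilting hQ).summandIntervals_eq_iff (hT'.isIntervalTilting hQ)]
    exact and_iff_left_of_imp fun h => congrArg _ (isoClass_eq_iff.1 h).support_eq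

theorem IsLinear.isUnimodularTiling_twoSupportTilting :
    IsUnimodularTiling (IsTwoSupportTilting (k := k) (Q := Q))
      (fun T => (T.1.isoClass, T.2.isoClass)) simplexTwo := by
  refine .of_signedJoin hQ.pos_injective (isSimplicialFan_compatibleSets pos dir)
    (isSimplicialFan_compatibleSets pos dir) intervalVec_nonneg intervalVec_nonneg
    (fun T => summandIntervals pos T.1) (fun T => summandIntervals pos T.2)
    (fun hT => (hT.1.isIntervalTilting hQ).isRigid.summandIntervals_mem_compatibleSets hQ)
    (fun hT => (hT.2.1.isIntervalTilting hQ).isRigid.summandIntervals_mem_compatibleSets hQ)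
    (fun hT q hq q' hq' => Set.disjoint_of_subset (support_intervalVec_subset hq)
      (support_intervalVec_subset hq') hT.2.2.disjoint)
    (fun _ _ hq => hq.1.intervalVec_mem_prefixDifferences)
    (fun _ _ hq => hq.1.intervalVec_mem_prefixDifferences) (fun hT => ?_)
    (fun _ => simplexTwo_eq hQ _) (fun hT hT' => ?_)
  · rw [(hT.1.isIntervalTilting hQ).ncard_eq, (hT.2.1.isIntervalTilting hQ).ncard_eq,
      ← hT.2.2.compl_eq, Set.ncard_add_ncard_compl, Nat.card_eq_fintype_card]
  · rw [(hT.1.isIntervalTilting hQ).summandIntervals_eq_iff (hT'.1.isIntervalTilting hQ),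
      (hT.2.1.isIntervalTilting hQ).summandIntervals_eq_iff (hT'.2.1.isIntervalTilting hQ),
      Prod.mk_inj]

end TiltingTilings

end QuiverRep

theorem mainTheorem2_general {k : Type u} [Field k] {Q : Type v} [Quiver.{w} Q] [Fintype Q]
    [DecidableEq Q] {pos : Q → ℕ} {dir : ℕ → Bool} (hQ : QuiverRep.IsLinear Q pos dir) :
    ((QuiverRep.tiltingClasses k Q).Finite ∧
      integralVolume (QuiverRep.polyTilt k Q) =
        ((QuiverRep.tiltingClasses k Q).ncard : ℝ≥0∞)) ∧
    ((QuiverRep.supportTiltingClasses k Q).Finite ∧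
      integralVolume (QuiverRep.polySupp k Q) =
        ((QuiverRep.supportTiltingClasses k Q).ncard : ℝ≥0∞)) ∧
    ((QuiverRep.twoSupportTiltingClasses k Q).Finite ∧
      integralVolume (QuiverRep.polyTwo k Q) =
        ((QuiverRep.twoSupportTiltingClasses k Q).ncard : ℝ≥0∞)) ∧
    (∀ T : QuiverRep k Q, T.IsTilting →
      IsUnimodularSimplex T.simplexTilt ∧ integralVolume T.simplexTilt = 1) ∧
    (∀ T : QuiverRep k Q, T.IsSupportTilting →
      IsUnimodularSimplex T.simplexSupp ∧ integralVolume T.simplexSupp = 1) ∧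
    (∀ T : QuiverRep k Q × QuiverRep k Q,
      QuiverRep.IsTwoSupportTilting T →
        IsUnimodularSimplex (QuiverRep.simplexTwo T) ∧
          integralVolume (QuiverRep.simplexTwo T) = 1) ∧
    (∀ T T' : QuiverRep k Q, T.IsTilting → T'.IsTilting →
      ¬ QuiverRep.IsIsomorphic T T' →
        volume (T.simplexTilt ∩ T'.simplexTilt) = 0) ∧
    (∀ T T' : QuiverRep k Q, T.IsSupportTilting → T'.IsSupportTilting →
      ¬ QuiverRep.IsIsomorphic T T' →
        volume (T.simplexSupp ∩ T'.simplexSupp) = 0) ∧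
    (∀ T T' : QuiverRep k Q × QuiverRep k Q,
      QuiverRep.IsTwoSupportTilting T → QuiverRep.IsTwoSupportTilting T' →
      ¬ (QuiverRep.IsIsomorphic T.1 T'.1 ∧ QuiverRep.IsIsomorphic T.2 T'.2) →
        volume (QuiverRep.simplexTwo T ∩ QuiverRep.simplexTwo T') = 0) := by
  have h₁ := hQ.isUnimodularTiling_tilting (k := k)
  have h₂ := hQ.isUnimodularTiling_supportTilting (k := k)
  have h₃ := hQ.isUnimodularTiling_twoSupportTilting (k := k)
  refine ⟨⟨h₁.finite_classes, h₁.integralVolume_eq_ncard⟩,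
    ⟨h₂.finite_classes, h₂.integralVolume_eq_ncard⟩,
    ⟨h₃.finite_classes, h₃.integralVolume_eq_ncard⟩,
    fun T hT => ⟨h₁.isUnimodularSimplex hT, (h₁.isUnimodularSimplex hT).integralVolume_eq_one⟩,
    fun T hT => ⟨h₂.isUnimodularSimplex hT, (h₂.isUnimodularSimplex hT).integralVolume_eq_one⟩,
    fun T hT => ⟨h₃.isUnimodularSimplex hT, (h₃.isUnimodularSimplex hT).integralVolume_eq_one⟩,
    fun T T' hT hT' hne => h₁.volume_inter hT hT' (mt QuiverRep.isoClass_eq_iff.1 hne),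
    fun T T' hT hT' hne => h₂.volume_inter hT hT' (mt QuiverRep.isoClass_eq_iff.1 hne),
    fun T T' hT hT' hne => h₃.volume_inter hT hT' fun heq => hne ?_⟩
  exact (Prod.mk_inj.1 heq).imp QuiverRep.isoClass_eq_iff.1 QuiverRep.isoClass_eq_iff.1

theorem mainTheorem2 {k : Type u} [Field k] (n : ℕ) (o : Fin (n - 1) → Bool) :
    ((QuiverRep.tiltingClasses k (TypeA n o)).Finite ∧
      integralVolume (QuiverRep.polyTilt k (TypeA n o)) =
        ((QuiverRep.tiltingClasses k (TypeA n o)).ncard : ℝ≥0∞)) ∧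
    ((QuiverRep.supportTiltingClasses k (TypeA n o)).Finite ∧
      integralVolume (QuiverRep.polySupp k (TypeA n o)) =
        ((QuiverRep.supportTiltingClasses k (TypeA n o)).ncard : ℝ≥0∞)) ∧
    ((QuiverRep.twoSupportTiltingClasses k (TypeA n o)).Finite ∧
      integralVolume (QuiverRep.polyTwo k (TypeA n o)) =
        ((QuiverRep.twoSupportTiltingClasses k (TypeA n o)).ncard : ℝ≥0∞)) ∧
    (∀ T : QuiverRep k (TypeA n o), T.IsTilting →
      IsUnimodularSimplex T.simplexTilt ∧ integralVolume T.simplexTilt = 1) ∧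
    (∀ T : QuiverRep k (TypeA n o), T.IsSupportTilting →
      IsUnimodularSimplex T.simplexSupp ∧ integralVolume T.simplexSupp = 1) ∧
    (∀ T : QuiverRep k (TypeA n o) × QuiverRep k (TypeA n o),
      QuiverRep.IsTwoSupportTilting T →
        IsUnimodularSimplex (QuiverRep.simplexTwo T) ∧
          integralVolume (QuiverRep.simplexTwo T) = 1) ∧
    (∀ T T' : QuiverRep k (TypeA n o), T.IsTilting → T'.IsTilting →
      ¬ QuiverRep.IsIsomorphic T T' →
        volume (T.simplexTilt ∩ T'.simplexTilt) = 0) ∧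
    (∀ T T' : QuiverRep k (TypeA n o), T.IsSupportTilting → T'.IsSupportTilting →
      ¬ QuiverRep.IsIsomorphic T T' →
        volume (T.simplexSupp ∩ T'.simplexSupp) = 0) ∧
    (∀ T T' : QuiverRep k (TypeA n o) × QuiverRep k (TypeA n o),
      QuiverRep.IsTwoSupportTilting T → QuiverRep.IsTwoSupportTilting T' →
      ¬ (QuiverRep.IsIsomorphic T.1 T'.1 ∧ QuiverRep.IsIsomorphic T.2 T'.2) →
        volume (QuiverRep.simplexTwo T ∩ QuiverRep.simplexTwo T') = 0) :=
  mainTheorem2_general TypeA.isLinear
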